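/- Let $\mathcal H$ be a complex Hilbert space and let $(H(t))_{t\in\mathbb R}$ be a family of bounded operators on $\mathcal H$ that is strongly continuous ($t\mapsto H(t)\psi$ is continuous for every $\psi\in\mathcal H$) and $1$-periodic ($H(t+1)=H(t)$ for all $t$). For $T>0$ put $H^{(T)}(t)=H(t/T)$. All operator integrals are strong (Bochner) integrals, i.e. $\big(\int_0^tA(s)\,ds\big)\psi=\int_0^tA(s)\psi\,ds$, and $\langle A\rangle_T=\frac1T\int_0^TA(s)\,ds$. *Effective Hamiltonians.* For $L\ge 0$ the operators $H_{\mathrm{eff},L}^{(T)}$ are defined recursively by $$H_{\mathrm{eff},L}^{(T)}=\Big[\langle H\rangle_1-\sum_{j=1}^{L}(-i)^j\big\langle K^{(T)}_{\cdot,L-j}\big(S^{(T)}_{j,L-j}(\cdot)\big)\big\rangle_T\Big]_{0;L},$$ where $[\,\cdot\,]_{0;L}$ is the truncation of a polynomial in $T$ to its terms of degree $0,\dots,L$, and, for every $M\ge 0$, $K^{(T)}_{t,M}(A)=H_{\mathrm{eff},M}^{(T)}A-A\,H^{(T)}(t)$, $S^{(T)}_{0,M}(t)=\mathbb 1$, and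 $$S^{(T)}_{j,M}(t)=\int_0^tK^{(T)}_{s,M}\big(S^{(T)}_{j-1,M}(s)\big)\,ds-t\,\big\langle K^{(T)}_{\cdot,M}\big(S^{(T)}_{j-1,M}(\cdot)\big)\big\rangle_T\qquad(j\ge 1).$$ *Truncated Floquet–Magnus expansion.* Let $H_{\mathrm{FM},L}^{(T)}=\sum_{l=0}^{L}\big(-\tfrac iT\big)\,\Omega_{l+1}^{(T)}(T)$, where $\Omega_1^{(T)}(t)=i\int_0^tH^{(T)}(\tau)\,d\tau$ and, for $l\ge2$, $$\Omega_l^{(T)}(t)=\sum_{j=1}^{l}\frac{B_j}{j!}\sum_{\substack{k_1+\dots+k_j=l-1\\k_1,\dots,k_j\ge1}}\int_0^t\operatorname{ad}_{\Omega^{(T)}_{k_1}(\tau)}\cdots\operatorname{ad}_{\Omega^{(T)}_{k_j}(\tau)}\big(iH^{(T)}(\tau)\big)\,d\tau,$$ with $\operatorname{ad}_A=[A,\cdot\,]$ and $B_j$ the Bernoulli numbers in the normalisation $B_1=+\tfrac12$. (Equivalently: replace $i$ by $-i$ in the three places where it occurs and take $B_1=-\tfrac12$.) **Theorem.** For every $L\ge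 0$ and every $T>0$, $$H_{\mathrm{eff},L}^{(T)}=H_{\mathrm{FM},L}^{(T)}.$$ In particular, if every $H(t)$ is symmetric, then $H_{\mathrm{eff},L}^{(T)}$ is symmetric and hence, being bounded, self-adjoint, for every $L\ge0$ and $T>0$. -/

import Mathlib

noncomputable section

namespace FloquetMagnus

open MeasureTheory

section Operators

variable {𝓗 : Type*} [NormedAddCommGroup 𝓗] [InnerProductSpace ℂ 𝓗]

/-- Strong continuity of a family of bounded operators. -/
def StronglyContinuous (A : ℝ → 𝓗 →L[ℂ] 𝓗) : Prop :=
  ∀ ψ : 𝓗, Continuous fun t => A t ψ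

/-- `I` is the strong integral of `A` from `0` to `t`: for every vector `ψ` the map `s ↦ A s ψ` is
Bochner integrable between `0` and `t`, and its integral is `I ψ`. -/
def IsStrongIntegral (A : ℝ → 𝓗 →L[ℂ] 𝓗) (t : ℝ) (I : 𝓗 →L[ℂ] 𝓗) : Prop :=
  ∀ ψ : 𝓗, IntervalIntegrable (fun s => A s ψ) volume 0 t ∧ I ψ = ∫ s in (0 : ℝ)..t, A s ψ

open Classical in
/-- The bounded operator `∫₀ᵗ A(s) ds`, defined strongly. It exists for every strongly continuous
family on a Hilbert space, see `isStrongIntegral_strongIntegral`. -/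
def strongIntegral (A : ℝ → 𝓗 →L[ℂ] 𝓗) (t : ℝ) : 𝓗 →L[ℂ] 𝓗 :=
  if h : ∃ I, IsStrongIntegral A t I then h.choose else 0

theorem isStrongIntegral_strongIntegral [CompleteSpace 𝓗] {A : ℝ → 𝓗 →L[ℂ] 𝓗}
    (hA : StronglyContinuous A) (t : ℝ) : IsStrongIntegral A t (strongIntegral A t) := by
  have hex : ∃ I, IsStrongIntegral A t I := by
    have hint : ∀ ψ, IntervalIntegrable (fun s => A s ψ) volume 0 t :=
      fun ψ => (hA ψ).intervalIntegrable 0 t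
    obtain ⟨C, hC⟩ : ∃ C, ∀ s : Set.uIcc (0 : ℝ) t, ‖A s‖ ≤ C := by
      refine banach_steinhaus fun ψ => ?_
      obtain ⟨C, hC⟩ := isCompact_uIcc.exists_bound_of_continuousOn (hA ψ).continuousOn
      exact ⟨C, fun s => hC s s.2⟩
    let I₀ : 𝓗 →ₗ[ℂ] 𝓗 :=
      { toFun := fun ψ => ∫ s in (0 : ℝ)..t, A s ψ
        map_add' := fun ψ φ => by
          simp only [map_add]
          exact intervalIntegral.integral_add (hint ψ) (hint φ)
        map_smul' := fun c ψ => by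
          simp only [map_smul, RingHom.id_apply]
          exact intervalIntegral.integral_smul c _ }
    refine ⟨I₀.mkContinuous (C * |t - 0|) fun ψ => ?_, fun ψ => ⟨hint ψ, rfl⟩⟩
    have hb : ∀ s ∈ Set.uIoc (0 : ℝ) t, ‖A s ψ‖ ≤ C * ‖ψ‖ := fun s hs =>
      (A s).le_of_opNorm_le (hC ⟨s, Set.uIoc_subset_uIcc hs⟩) ψ
    calc ‖I₀ ψ‖ ≤ C * ‖ψ‖ * |t - 0| := intervalIntegral.norm_integral_le_of_norm_le_const hb
      _ = C * |t - 0| * ‖ψ‖ := by ring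
  have : strongIntegral A t = hex.choose := dif_pos hex
  rw [this]
  exact hex.choose_spec

/-- The `T`-average `(1/T) ∫₀ᵀ A(s) ds`. -/
def average (T : ℝ) (A : ℝ → 𝓗 →L[ℂ] 𝓗) : 𝓗 →L[ℂ] 𝓗 :=
  ((1 / T : ℝ) : ℂ) • strongIntegral A T

/-- The rescaled family `H^(T)(t) = H(t/T)`. -/
def rescale (H : ℝ → 𝓗 →L[ℂ] 𝓗) (T : ℝ) : ℝ → 𝓗 →L[ℂ] 𝓗 :=
  fun t => H (t / T)

/-- `K_t(A) = H₁(t) A - A H₂(t)`. -/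
def relAction (H₁ H₂ : ℝ → 𝓗 →L[ℂ] 𝓗) (t : ℝ) (A : 𝓗 →L[ℂ] 𝓗) : 𝓗 →L[ℂ] 𝓗 :=
  H₁ t * A - A * H₂ t

/-- The iterated actions `S_j(t)`: `S_0 = 1` and
`S_{j+1}(t) = ∫₀ᵗ K_s(S_j(s)) ds - t ⟨K(S_j)⟩_T`. -/
def iterAction (T : ℝ) (H₁ H₂ : ℝ → 𝓗 →L[ℂ] 𝓗) : ℕ → ℝ → 𝓗 →L[ℂ] 𝓗
  | 0 => fun _ => 1
  | j + 1 => fun t =>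
      strongIntegral (fun s => relAction H₁ H₂ s (iterAction T H₁ H₂ j s)) t
        - (t : ℂ) • average T (fun s => relAction H₁ H₂ s (iterAction T H₁ H₂ j s))

/-- `c` is the sequence of coefficients of the family `(A_T)_{T>0}` as a polynomial in `T`. -/
def IsPolynomialWith (A : ℝ → 𝓗 →L[ℂ] 𝓗) (c : ℕ →₀ (𝓗 →L[ℂ] 𝓗)) : Prop :=
  ∀ T : ℝ, 0 < T → A T = ∑ k ∈ c.support, ((T ^ k : ℝ) : ℂ) • c k

open Classical in
/-- The coefficient of `T ^ k` of a family `(A_T)_{T>0}` that is polynomial in `T`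
(the coefficients are unique, see `IsPolynomialWith.unique`). -/
def polyCoeff (A : ℝ → 𝓗 →L[ℂ] 𝓗) (k : ℕ) : 𝓗 →L[ℂ] 𝓗 :=
  if h : ∃ c, IsPolynomialWith A c then h.choose k else 0

theorem IsPolynomialWith.unique {A : ℝ → 𝓗 →L[ℂ] 𝓗} {c d : ℕ →₀ (𝓗 →L[ℂ] 𝓗)}
    (hc : IsPolynomialWith A c) (hd : IsPolynomialWith A d) : c = d := by
  classical
  ext k ψ
  refine ext_inner_left ℂ fun φ => ?_
  let p : (ℕ →₀ (𝓗 →L[ℂ] 𝓗)) → Polynomial ℂ := fun c =>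
    ∑ k ∈ c.support, Polynomial.monomial k (inner ℂ φ (c k ψ))
  have hp : ∀ c k, (p c).coeff k = inner ℂ φ (c k ψ) := by
    intro c k
    simp only [p, Polynomial.finsetSum_coeff, Polynomial.coeff_monomial]
    rw [Finset.sum_ite_eq' c.support k]
    split_ifs with h
    · rfl
    · simp [Finsupp.notMem_support_iff.1 h]
  have hev : ∀ c, IsPolynomialWith A c → ∀ T : ℝ, 0 < T →
      (p c).eval (T : ℂ) = inner ℂ φ (A T ψ) := by
    intro c hc T hT
    rw [hc T hT]
    simp [p, Polynomial.eval_finsetSum, mul_comm]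
  have : p c = p d := by
    refine Polynomial.eq_of_infinite_eval_eq _ _
      (Set.Infinite.mono (s := (fun T : ℝ => (T : ℂ)) '' Set.Ioi 0) ?_ ?_)
    · rintro _ ⟨T, hT, rfl⟩
      exact (hev c hc T hT).trans (hev d hd T hT).symm
    · exact (Set.Ioi_infinite (0 : ℝ)).image Complex.ofReal_injective.injOn
  rw [← hp c k, ← hp d k, this]

theorem IsPolynomialWith.polyCoeff_eq {A : ℝ → 𝓗 →L[ℂ] 𝓗} {c : ℕ →₀ (𝓗 →L[ℂ] 𝓗)}
    (hc : IsPolynomialWith A c) (k : ℕ) : polyCoeff A k = c k := by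
  have hex : ∃ c, IsPolynomialWith A c := ⟨c, hc⟩
  have : polyCoeff A k = hex.choose k := dif_pos hex
  rw [this, hex.choose_spec.unique hc]

/-- The truncation of a polynomial family to degree from `0` to `L`. -/
def polyTrunc (A : ℝ → 𝓗 →L[ℂ] 𝓗) (L : ℕ) : ℝ → 𝓗 →L[ℂ] 𝓗 :=
  fun T => ∑ k ∈ Finset.range (L + 1), ((T ^ k : ℝ) : ℂ) • polyCoeff A k

/-- The effective Hamiltonian of order `L`, as a function of the period `T`: the truncation to degree
`L` in `T` of `⟨H⟩_1 - ∑_{j=1}^L (-i)^j ⟨K(S_j)⟩_T`, where `K` and `S_j` are formed with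
`H₁ = Heff (L - j) T` (independent of time) and `H₂ = H^(T)`.
The index `j : Fin L` stands for the summation index `j + 1`. -/
def Heff (H : ℝ → 𝓗 →L[ℂ] 𝓗) (L : ℕ) : ℝ → 𝓗 →L[ℂ] 𝓗 :=
  polyTrunc (fun T => average 1 H - ∑ j : Fin L, (-Complex.I) ^ (j.val + 1) •
    average T (fun s => relAction (fun _ => Heff H (L - (j.val + 1)) T) (rescale H T) s
      (iterAction T (fun _ => Heff H (L - (j.val + 1)) T) (rescale H T) (j.val + 1) s))) L
termination_by L
decreasing_by all_goals have := j.isLt; omega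

/-- The terms `Ω_l(t)` of the Magnus series of `A`: `Ω_1(t) = ∫₀ᵗ A(τ) dτ` and, for `l ≥ 2`,
`Ω_l(t) = ∑_{j=1}^l (B_j / j!) ∑_{k₁+⋯+k_j=l-1, k_i≥1} ∫₀ᵗ [Ω_{k₁}(τ), [⋯, [Ω_{k_j}(τ), A(τ)]]] dτ`,
with `B_j` the Bernoulli numbers normalised by `B_1 = 1/2`.
(`Ω_0 = 0` is a filler. The bound `k_i < l` follows from `k₁ + ⋯ + k_j = l - 1`.) -/
def magnusTerm (A : ℝ → 𝓗 →L[ℂ] 𝓗) (l : ℕ) : ℝ → 𝓗 →L[ℂ] 𝓗 :=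
  if l = 0 then 0
  else if l = 1 then strongIntegral A
  else fun t => ∑ j ∈ Finset.Icc 1 l, ((bernoulli' j / (j.factorial : ℚ) : ℚ) : ℂ) •
    ∑ k : Fin j → Fin l with (∀ i, 1 ≤ (k i).val) ∧ ∑ i, (k i).val = l - 1,
      strongIntegral (fun τ =>
        (List.ofFn fun i : Fin j => magnusTerm A (k i).val τ).foldr (fun X Y => ⁅X, Y⁆) (A τ)) t
termination_by l
decreasing_by all_goals exact (k i).isLt

/-- The `l`-th term `-(i/T) Ω_{l+1}^(T)(T)` of the Floquet-Magnus expansion, where `Ω^(T)` is formed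
with `i H^(T)`. -/
def HFMTerm (H : ℝ → 𝓗 →L[ℂ] 𝓗) (l : ℕ) (T : ℝ) : 𝓗 →L[ℂ] 𝓗 :=
  (-(Complex.I / (T : ℂ))) • magnusTerm (fun t => Complex.I • rescale H T t) (l + 1) T

/-- The `L`-th truncation of the Floquet-Magnus expansion. -/
def HFM (H : ℝ → 𝓗 →L[ℂ] 𝓗) (L : ℕ) (T : ℝ) : 𝓗 →L[ℂ] 𝓗 :=
  ∑ l ∈ Finset.range (L + 1), HFMTerm H l T

end Operators

end FloquetMagnus

end

/-!
All statements are first proved for formal power series in a variable `X`, which stands for the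
period `T`, with coefficients in the algebra of strongly continuous families of operators
(`strongFamilies`). The Leibniz rule holds there for strong derivatives (`HasStrongDeriv.mul`).

Put `a = i H` and let `Ω = ∑ Ω_l X ^ l` be the Magnus series (`magnusSeries`). Its defining recursion
is the equation `Ω' = β (X a)` with `β = ad_Ω / (1 - exp (-ad_Ω))`. Together with the formula for the
derivative of the exponential (`lsum_powDeriv`), which rests on the inverse power series
`(1 - exp (-x)) / x` and `x / (1 - exp (-x))`, it shows that `Y = exp Ω` solves `Y' = Y (X a)`,
`Y(0) = 1`. The formal Floquet-Magnus Hamiltonian `E` (`floquetSeries`) is given by `i X E = Ω(1)`.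

On the other side, let `S_j` be the iterated actions for period `1` formed with `E` and `H`, let
`κ_j` be the average of `E S_j - S_j H`, and put `Q = ∑ (-i X) ^ j S_j`, `k = ∑ (-i X) ^ j κ_j`. Summing
the equations for the `S_j` gives `Q' = -i X (E Q - Q H - k)` with `Q(0) = Q(1) = 1`. With
`G = exp (t Ω(1))` the series `Z = G Q - Y` satisfies `Z' = X (Z a + i G k)`, and `Z(0) = Z(1) = 0`
because `G(1) = exp (Ω(1)) = Y(1)`. Comparing coefficients order by order, this forces `k = 0`
(`meanGen_floquetSeries`). Since `κ_0 = E - ⟨H⟩`, this reads `E = ⟨H⟩ - ∑_{j ≥ 1} (-i X) ^ j κ_j`: the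
Floquet-Magnus Hamiltonian solves the equation of which the effective Hamiltonians are the
truncations, and an induction on the order identifies them (`Heff_eq_sum`).

Time is rescaled to period `1` throughout. The powers of `T` then come from the homogeneity of the
integrals (`magnusTerm_mul_left`, `average_relAction_eq`). For symmetric `H(t)` the Magnus terms of
`i H` are skew-adjoint (`star_magnusTerm`), which gives the second half of the theorem.
-/

noncomputable section

namespace FloquetMagnus

open PowerSeries Finset Filter Topology

/-! ### Formal power series with noncommutative coefficients and their exponential -/

section FormalAlgebra

variable {R : Type*} [Ring R]

theorem X_pow_add_dvd_mul {a b : ℕ} {f g : R⟦X⟧} (hf : X ^ a ∣ f) (hg : X ^ b ∣ g) :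
    X ^ (a + b) ∣ f * g := by
  obtain ⟨f, rfl⟩ := hf
  obtain ⟨g, rfl⟩ := hg
  refine ⟨f * g, ?_⟩
  rw [pow_add, mul_assoc, ← mul_assoc f, ← (commute_X_pow f b).eq.symm]
  simp only [mul_assoc]

/-- The sum of a family of power series whose `k`-th member is divisible by `X ^ k`. For other
families the value is meaningless. -/
def lsum (f : ℕ → R⟦X⟧) : R⟦X⟧ :=
  PowerSeries.mk fun n => ∑ k ∈ range (n + 1), coeff n (f k)

theorem coeff_lsum {f : ℕ → R⟦X⟧} (hf : ∀ k, X ^ k ∣ f k) {n N : ℕ} (hN : n < N) :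
    coeff n (lsum f) = ∑ k ∈ range N, coeff n (f k) := by
  rw [lsum, coeff_mk]
  refine sum_subset (by simpa using hN) fun k _ hk => ?_
  exact X_pow_dvd_iff.1 (hf k) n (by simpa using hk)

theorem X_pow_dvd_lsum {f : ℕ → R⟦X⟧} {m : ℕ} (hf : ∀ k, X ^ m ∣ f k) : X ^ m ∣ lsum f := by
  rw [X_pow_dvd_iff]
  intro n hn
  rw [lsum, coeff_mk]
  exact sum_eq_zero fun k _ => X_pow_dvd_iff.1 (hf k) n hn

/-- A Fubini theorem: a double sum may be grouped along antidiagonals. -/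
theorem lsum_lsum {f : ℕ → ℕ → R⟦X⟧} (hf : ∀ a b, X ^ (a + b) ∣ f a b) :
    lsum (fun a => lsum (f a)) = lsum fun n => ∑ p ∈ antidiagonal n, f p.1 p.2 := by
  ext n
  simp only [lsum, coeff_mk, map_sum, Nat.sum_antidiagonal_eq_sum_range_succ_mk]
  rw [sum_range_diag_flip (n + 1) fun a b => coeff n (f a b)]
  refine sum_congr rfl fun a _ => (sum_subset (by simp) fun b _ hb => ?_).symm
  exact X_pow_dvd_iff.1 (hf a b) n (by simp at hb; omega)

/-- Additive maps which are continuous for the `X`-adic topology commute with sums. -/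
theorem map_lsum (L : R⟦X⟧ →+ R⟦X⟧) (hL : ∀ n x, X ^ n ∣ x → X ^ n ∣ L x) {f : ℕ → R⟦X⟧}
    (hf : ∀ k, X ^ k ∣ f k) : L (lsum f) = lsum fun k => L (f k) := by
  ext n
  have hd : X ^ (n + 1) ∣ lsum f - ∑ k ∈ range (n + 1), f k := by
    rw [X_pow_dvd_iff]
    intro m hm
    rw [map_sub, coeff_lsum hf hm, map_sum, sub_self]
  have h := X_pow_dvd_iff.1 (hL _ _ hd) n n.lt_succ_self
  rw [map_sub, map_sub, sub_eq_zero] at h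
  rw [h, lsum, coeff_mk, map_sum, map_sum]

theorem lsum_mul {f : ℕ → R⟦X⟧} (hf : ∀ k, X ^ k ∣ f k) (g : R⟦X⟧) :
    lsum f * g = lsum fun k => f k * g :=
  map_lsum (AddMonoidHom.mulRight g) (fun _ _ h => Dvd.dvd.mul_right h g) hf

theorem X_pow_dvd_mul_left {n : ℕ} {f : R⟦X⟧} (g : R⟦X⟧) (hf : X ^ n ∣ f) : X ^ n ∣ g * f := by
  simpa using X_pow_add_dvd_mul (a := 0) (by simp) hf

theorem mul_lsum {f : ℕ → R⟦X⟧} (hf : ∀ k, X ^ k ∣ f k) (g : R⟦X⟧) :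
    g * lsum f = lsum fun k => g * f k :=
  map_lsum (AddMonoidHom.mulLeft g) (fun _ _ h => X_pow_dvd_mul_left g h) hf

theorem X_pow_dvd_pow {ω : R⟦X⟧} (hω : X ∣ ω) (k : ℕ) : X ^ k ∣ ω ^ k := by
  induction k with
  | zero => simp
  | succ k ih => exact X_pow_add_dvd_mul ih (by simpa using hω)

variable [Algebra ℂ R]

theorem coeff_complex_smul (n : ℕ) (c : ℂ) (f : R⟦X⟧) : coeff n (c • f) = c • coeff n f := rfl

theorem X_pow_dvd_smul {n : ℕ} {f : R⟦X⟧} (c : ℂ) (hf : X ^ n ∣ f) : X ^ n ∣ c • f := by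
  rw [X_pow_dvd_iff] at hf ⊢
  intro m hm
  rw [coeff_complex_smul, hf m hm, smul_zero]

/-- The commutator map `x ↦ ω x - x ω`. -/
def adMap (ω : R⟦X⟧) : Module.End ℂ R⟦X⟧ :=
  LinearMap.mulLeft ℂ ω - LinearMap.mulRight ℂ ω

theorem adMap_apply (ω x : R⟦X⟧) : adMap ω x = ω * x - x * ω := rfl

theorem X_pow_dvd_adMap {ω x : R⟦X⟧} {n : ℕ} (hx : X ^ n ∣ x) : X ^ n ∣ adMap ω x :=
  dvd_sub (X_pow_dvd_mul_left ω hx) (Dvd.dvd.mul_right hx ω)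

theorem X_pow_dvd_adMap_pow {ω x : R⟦X⟧} {n : ℕ} (hω : X ∣ ω) (hx : X ^ n ∣ x) (m : ℕ) :
    X ^ (m + n) ∣ (adMap ω ^ m) x := by
  induction m with
  | zero => simpa using hx
  | succ m ih =>
    rw [pow_succ', Module.End.mul_apply, adMap_apply]
    have h1 : X ^ 1 ∣ ω := by simpa using hω
    refine dvd_sub ?_ ?_
    · convert X_pow_add_dvd_mul h1 ih using 2; omega
    · convert X_pow_add_dvd_mul ih h1 using 2; omega

theorem adMap_pow_dvd {ω x : R⟦X⟧} {n : ℕ} (hx : X ^ n ∣ x) (m : ℕ) :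
    X ^ n ∣ (adMap ω ^ m) x := by
  induction m with
  | zero => simpa using hx
  | succ m ih => rw [pow_succ']; exact X_pow_dvd_adMap ih

/-- The exponential of a power series without constant term. -/
def psExp (ω : R⟦X⟧) : R⟦X⟧ :=
  lsum fun k => ((k.factorial : ℂ)⁻¹) • ω ^ k

/-- The value which the Leibniz rule gives to the derivative of `a ^ k`, when that of `a` is `b`. -/
def powDeriv {A : Type*} [Ring A] (a b : A) : ℕ → A
  | 0 => 0
  | k + 1 => a * powDeriv a b k + b * a ^ k

/-- The derivative of `a ^ (n + 1) / (n + 1)!`, with all commutators moved to the right. -/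
theorem factorial_smul_powDeriv (a b : R⟦X⟧) (n : ℕ) :
    (((n + 1).factorial : ℂ)⁻¹) • powDeriv a b (n + 1) =
      ∑ p ∈ antidiagonal n, ((p.1.factorial : ℂ)⁻¹) • a ^ p.1 *
        (((-1) ^ p.2 * ((p.2 + 1).factorial : ℂ)⁻¹) • (adMap a ^ p.2) b) := by
  -- Right multiplication by `a` is left multiplication minus the commutator, and these commute.
  have hbin : ∀ n : ℕ, b * a ^ n = ∑ p ∈ antidiagonal n,
      ((n.choose p.1 : ℂ) * (-1) ^ p.2) • (a ^ p.1 * (adMap a ^ p.2) b) := by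
    intro n
    have hc : Commute (LinearMap.mulLeft ℂ a) (-adMap a) := by
      refine Commute.neg_right (Commute.sub_right (Commute.refl _) ?_)
      exact LinearMap.commute_mulLeft_right a a
    have h : LinearMap.mulRight ℂ a = LinearMap.mulLeft ℂ a + -adMap a := by
      simp [adMap]
    calc b * a ^ n = (LinearMap.mulRight ℂ a ^ n) b := by simp
      _ = _ := by
        rw [h, hc.add_pow', LinearMap.sum_apply]
        refine sum_congr rfl fun p _ => ?_
        rw [LinearMap.smul_apply, LinearMap.pow_mulLeft, mul_smul, Nat.cast_smul_eq_nsmul,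
          ← neg_one_smul ℂ (adMap a), smul_pow, mul_smul_comm,
          LinearMap.smul_apply]
        rfl
  induction n with
  | zero => simp [powDeriv]
  | succ n ih =>
    have hn : ((n + 1 + 1 : ℕ) : ℂ) ≠ 0 := Nat.cast_ne_zero.2 (Nat.succ_ne_zero _)
    -- After multiplication by `n + 2 = p.1 + (p.2 + 1)` the two summands yield the two terms of the
    -- Leibniz recursion.
    have key : ((n + 1 + 1 : ℕ) : ℂ) • ∑ p ∈ antidiagonal (n + 1), ((p.1.factorial : ℂ)⁻¹) •
          a ^ p.1 * (((-1) ^ p.2 * ((p.2 + 1).factorial : ℂ)⁻¹) • (adMap a ^ p.2) b) =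
        a * ((((n + 1).factorial : ℂ)⁻¹) • powDeriv a b (n + 1)) +
          (((n + 1).factorial : ℂ)⁻¹) • (b * a ^ (n + 1)) := by
      have hsplit : ((n + 1 + 1 : ℕ) : ℂ) • ∑ p ∈ antidiagonal (n + 1), ((p.1.factorial : ℂ)⁻¹) •
          a ^ p.1 * (((-1) ^ p.2 * ((p.2 + 1).factorial : ℂ)⁻¹) • (adMap a ^ p.2) b) =
          ∑ p ∈ antidiagonal (n + 1), ((p.1 : ℂ) * (p.1.factorial : ℂ)⁻¹) •
          a ^ p.1 * (((-1) ^ p.2 * ((p.2 + 1).factorial : ℂ)⁻¹) • (adMap a ^ p.2) b) +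
          ∑ p ∈ antidiagonal (n + 1), ((p.1.factorial : ℂ)⁻¹) •
          a ^ p.1 * (((-1) ^ p.2 * (p.2.factorial : ℂ)⁻¹) • (adMap a ^ p.2) b) := by
        rw [smul_sum, ← sum_add_distrib]
        refine sum_congr rfl fun p hp => ?_
        rw [HasAntidiagonal.mem_antidiagonal] at hp
        have h2 : ((p.2 + 1 : ℕ) : ℂ) ≠ 0 := Nat.cast_ne_zero.2 (Nat.succ_ne_zero _)
        have h3 : (p.2.factorial : ℂ) ≠ 0 := Nat.cast_ne_zero.2 (Nat.factorial_ne_zero _)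
        simp only [smul_mul_assoc, mul_smul_comm, smul_smul, ← add_smul]
        congr 1
        rw [← hp, Nat.factorial_succ]
        push_cast at h2 ⊢
        field_simp
        ring
      rw [hsplit, ih, hbin]
      congr 1
      · rw [Nat.sum_antidiagonal_succ, mul_sum]
        simp only [Nat.cast_zero, zero_mul, zero_smul, zero_add]
        refine sum_congr rfl fun p _ => ?_
        have h2 : ((p.1 + 1 : ℕ) : ℂ) ≠ 0 := Nat.cast_ne_zero.2 (Nat.succ_ne_zero _)
        simp only [smul_mul_assoc, mul_smul_comm, smul_smul]
        rw [pow_succ', mul_assoc a]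
        congr 1
        have h3 : (p.1.factorial : ℂ) ≠ 0 := Nat.cast_ne_zero.2 (Nat.factorial_ne_zero _)
        rw [Nat.factorial_succ p.1, Nat.cast_mul, mul_inv]
        field_simp
      · rw [smul_sum]
        refine sum_congr rfl fun p hp => ?_
        rw [HasAntidiagonal.mem_antidiagonal] at hp
        simp only [smul_mul_assoc, mul_smul_comm, smul_smul]
        congr 1
        have h3 : ∀ m : ℕ, (m.factorial : ℂ) ≠ 0 :=
          fun m => Nat.cast_ne_zero.2 (Nat.factorial_ne_zero _)
        rw [← hp, Nat.cast_add_choose]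
        field_simp [h3]
    have hfac : (((n + 1 + 1).factorial : ℂ)⁻¹) =
        ((n + 1 + 1 : ℕ) : ℂ)⁻¹ * ((n + 1).factorial : ℂ)⁻¹ := by
      rw [Nat.factorial_succ (n + 1), Nat.cast_mul, mul_inv]
    rw [← inv_smul_smul₀ hn (∑ p ∈ antidiagonal (n + 1), _), key, hfac, mul_smul]
    congr 1
    rw [powDeriv, smul_add, mul_smul_comm]

/-- The coefficients of `x / (1 - exp (-x))`. -/
def bernCoeff (j : ℕ) : ℂ := ((bernoulli' j / (j.factorial : ℚ) : ℚ) : ℂ)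

/-- The power series `(1 - exp (-x)) / x` and `x / (1 - exp (-x))` are inverse to each other. -/
theorem sum_antidiagonal_bernCoeff (n : ℕ) :
    ∑ p ∈ antidiagonal n, ((-1) ^ p.1 * ((p.1 + 1).factorial : ℂ)⁻¹) * bernCoeff p.2 =
      if n = 0 then 1 else 0 := by
  let φ : ℂ⟦X⟧ := PowerSeries.mk fun m => (-1) ^ m * ((m + 1).factorial : ℂ)⁻¹
  have hβ : bernoulli'PowerSeries ℂ = PowerSeries.mk bernCoeff := by
    ext j
    simp [bernoulli'PowerSeries, bernCoeff]
  have hφ : X * φ = 1 - evalNegHom (exp ℂ) := by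
    ext m
    rcases m with _ | m
    · rw [map_sub, evalNegHom, coeff_rescale, coeff_exp]
      simp
    · rw [coeff_succ_X_mul, map_sub, coeff_one, if_neg m.succ_ne_zero, evalNegHom, coeff_rescale,
        coeff_exp, coeff_mk]
      simp [pow_succ]
  have h1 : bernoulli'PowerSeries ℂ * (X * φ) = X := by
    have := congrArg (· * evalNegHom (exp ℂ)) (bernoulli'PowerSeries_mul_exp_sub_one ℂ)
    simp only [sub_mul, mul_assoc, exp_mul_exp_neg_eq_one, one_mul, mul_one] at this
    rw [hφ, this]
  have h2 : φ * PowerSeries.mk bernCoeff = 1 := by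
    apply X_mul_cancel
    rw [mul_one, ← hβ, ← mul_assoc, mul_comm, h1]
  have h3 := congrArg (coeff n) h2
  rw [coeff_mul, coeff_one] at h3
  simpa [φ] using h3

/-- The derivative of the exponential. If `ω` is the value at `x` of the operator
`ad_a / (1 - exp (-ad_a))`, then the derivative of `exp a` in the direction `ω` is `exp a * x`. -/
theorem lsum_powDeriv {a x : R⟦X⟧} (ha : X ∣ a) (hx : X ∣ x) :
    lsum (fun k => ((k.factorial : ℂ)⁻¹) •
      powDeriv a (lsum fun j => bernCoeff j • (adMap a ^ j) x) k) = psExp a * x := by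
  set ω := lsum fun j => bernCoeff j • (adMap a ^ j) x with hω
  have hx1 : X ^ 1 ∣ x := by simpa using hx
  have hω1 : X ^ 1 ∣ ω := X_pow_dvd_lsum fun j => X_pow_dvd_smul _ (adMap_pow_dvd hx1 j)
  have hinner : lsum (fun m => ((-1) ^ m * ((m + 1).factorial : ℂ)⁻¹) • (adMap a ^ m) ω) = x := by
    have hterm : ∀ m, ((-1) ^ m * ((m + 1).factorial : ℂ)⁻¹) • (adMap a ^ m) ω =
        lsum fun j => (((-1) ^ m * ((m + 1).factorial : ℂ)⁻¹) * bernCoeff j) •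
          (adMap a ^ (m + j)) x := by
      intro m
      rw [hω, show ((-1) ^ m * ((m + 1).factorial : ℂ)⁻¹) • (adMap a ^ m)
        (lsum fun j => bernCoeff j • (adMap a ^ j) x) =
        (((-1) ^ m * ((m + 1).factorial : ℂ)⁻¹) • (adMap a ^ m)).toAddMonoidHom
        (lsum fun j => bernCoeff j • (adMap a ^ j) x) from rfl, map_lsum]
      · congr 1
        ext1 j
        simp [pow_add, mul_smul, smul_comm (bernCoeff j)]
      · exact fun n y hy => X_pow_dvd_smul _ (adMap_pow_dvd hy m)
      · exact fun k => X_pow_dvd_smul _ (X_pow_dvd_adMap_pow (n := 0) ha (by simp) k)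
    simp only [hterm]
    rw [lsum_lsum fun m j => X_pow_dvd_smul _ (X_pow_dvd_adMap_pow (n := 0) ha (by simp) (m + j))]
    have hs : ∀ n, ∑ p ∈ antidiagonal n, (((-1) ^ p.1 * ((p.1 + 1).factorial : ℂ)⁻¹) *
        bernCoeff p.2) • (adMap a ^ (p.1 + p.2)) x = if n = 0 then x else 0 := by
      intro n
      have : ∀ p ∈ antidiagonal n, (((-1) ^ p.1 * ((p.1 + 1).factorial : ℂ)⁻¹) *
          bernCoeff p.2) • (adMap a ^ (p.1 + p.2)) x = (((-1) ^ p.1 *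
          ((p.1 + 1).factorial : ℂ)⁻¹) * bernCoeff p.2) • (adMap a ^ n) x := by
        intro p hp
        rw [HasAntidiagonal.mem_antidiagonal.1 hp]
      rw [sum_congr rfl this, ← sum_smul, sum_antidiagonal_bernCoeff]
      split_ifs with h <;> simp [h]
    simp only [hs]
    ext n
    rw [lsum, coeff_mk, sum_eq_single 0] <;> simp +contextual
  have hpd : ∀ k, X ^ k ∣ ((k.factorial : ℂ)⁻¹) • powDeriv a ω k := by
    intro k
    refine X_pow_dvd_smul _ ?_
    induction k with
    | zero => simp
    | succ k ih =>
      have h1 : X ^ 1 ∣ a := by simpa using ha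
      rw [powDeriv, add_comm k 1]
      exact dvd_add (X_pow_add_dvd_mul h1 ih) (X_pow_add_dvd_mul hω1 (X_pow_dvd_pow ha k))
  have hfam : ∀ m, X ^ m ∣ ((-1) ^ m * ((m + 1).factorial : ℂ)⁻¹) • (adMap a ^ m) ω :=
    fun m => X_pow_dvd_smul _ (X_pow_dvd_adMap_pow (n := 0) ha (by simp) m)
  calc _ = lsum fun n => ∑ p ∈ antidiagonal n, ((p.1.factorial : ℂ)⁻¹) • a ^ p.1 *
        (((-1) ^ p.2 * ((p.2 + 1).factorial : ℂ)⁻¹) • (adMap a ^ p.2) ω) := by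
        ext n
        rw [coeff_lsum hpd (show n < n + 1 + 1 by omega), sum_range_succ', lsum, coeff_mk]
        simp only [factorial_smul_powDeriv]
        simp [powDeriv]
    _ = lsum fun k => (((k.factorial : ℂ)⁻¹) • a ^ k) * x := by
        rw [← lsum_lsum (f := fun m j => ((m.factorial : ℂ)⁻¹) • a ^ m *
          (((-1) ^ j * ((j + 1).factorial : ℂ)⁻¹) • (adMap a ^ j) ω))]
        · simp only [← mul_lsum hfam, hinner]
        · exact fun m j => X_pow_add_dvd_mul (X_pow_dvd_smul _ (X_pow_dvd_pow ha m)) (hfam j)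
    _ = psExp a * x := (lsum_mul (fun k => X_pow_dvd_smul _ (X_pow_dvd_pow ha k)) x).symm

end FormalAlgebra

/-! ### Strongly continuous families of operators and their strong derivatives -/

section StrongFamilies

variable {𝓗 : Type*} [NormedAddCommGroup 𝓗] [InnerProductSpace ℂ 𝓗] [CompleteSpace 𝓗]

/-- On strongly continuous families, the evaluation of operators on vectors is jointly
continuous. This is where the uniform boundedness principle enters. -/
theorem StronglyContinuous.tendsto_apply {A : ℝ → 𝓗 →L[ℂ] 𝓗} (hA : StronglyContinuous A)
    {t₀ : ℝ} {l : Filter ℝ} (hl : l ≤ 𝓝 t₀) {x : ℝ → 𝓗} {y : 𝓗} (hx : Tendsto x l (𝓝 y)) :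
    Tendsto (fun t => A t (x t)) l (𝓝 (A t₀ y)) := by
  obtain ⟨C, hC⟩ : ∃ C, ∀ s : Set.Icc (t₀ - 1) (t₀ + 1), ‖A s‖ ≤ C := by
    refine banach_steinhaus fun ψ => ?_
    obtain ⟨C, hC⟩ := isCompact_Icc.exists_bound_of_continuousOn (hA ψ).continuousOn
    exact ⟨C, fun s => hC s s.2⟩
  have hnear : ∀ᶠ t in l, t ∈ Set.Icc (t₀ - 1) (t₀ + 1) :=
    hl (Icc_mem_nhds (by linarith) (by linarith))
  have h1 : Tendsto (fun t => A t (x t - y)) l (𝓝 0) := by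
    refine squeeze_zero_norm' (a := fun t => C * ‖x t - y‖) ?_ ?_
    · filter_upwards [hnear] with t ht
      exact (A t).le_of_opNorm_le (hC ⟨t, ht⟩) _
    · have := (tendsto_iff_norm_sub_tendsto_zero.1 hx).const_mul C
      simpa using this
  have h2 : Tendsto (fun t => A t y) l (𝓝 (A t₀ y)) := ((hA y).tendsto t₀).mono_left hl
  simpa using h1.add h2

theorem StronglyContinuous.mul {A B : ℝ → 𝓗 →L[ℂ] 𝓗} (hA : StronglyContinuous A)
    (hB : StronglyContinuous B) : StronglyContinuous fun t => A t * B t := fun ψ =>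
  continuous_iff_continuousAt.2 fun _ => hA.tendsto_apply le_rfl (hB ψ).continuousAt

variable (𝓗) in
/-- The algebra of strongly continuous families of bounded operators. -/
def strongFamilies : Subalgebra ℂ (ℝ → 𝓗 →L[ℂ] 𝓗) where
  carrier := {A | StronglyContinuous A}
  mul_mem' := fun hA hB => hA.mul hB
  add_mem' := fun hA hB ψ => (hA ψ).add (hB ψ)
  algebraMap_mem' := fun _ _ => continuous_const

/-- The value of a strongly continuous family at time `t`. -/
def evalAt (t : ℝ) : strongFamilies 𝓗 →ₐ[ℂ] (𝓗 →L[ℂ] 𝓗) :=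
  (Pi.evalAlgHom ℂ (fun _ : ℝ => 𝓗 →L[ℂ] 𝓗) t).comp (strongFamilies 𝓗).val

theorem strongFamilies_ext {a b : strongFamilies 𝓗} (h : ∀ t, evalAt t a = evalAt t b) : a = b :=
  Subtype.ext (funext h)

/-- The constant families. -/
def constFamily : (𝓗 →L[ℂ] 𝓗) →ₐ[ℂ] strongFamilies 𝓗 where
  toFun := fun A => ⟨fun _ => A, fun _ => continuous_const⟩
  map_one' := rfl
  map_mul' := fun _ _ => rfl
  map_zero' := rfl
  map_add' := fun _ _ => rfl
  commutes' := fun _ => rfl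

theorem evalAt_constFamily (t : ℝ) (A : 𝓗 →L[ℂ] 𝓗) : evalAt t (constFamily A) = A := rfl

variable (𝓗) in
/-- The family `t ↦ t` of scalar operators. -/
def timeFamily : strongFamilies 𝓗 :=
  ⟨fun t => (t : ℂ) • 1, fun _ => Complex.continuous_ofReal.smul continuous_const⟩

theorem evalAt_timeFamily (t : ℝ) : evalAt t (timeFamily 𝓗) = (t : ℂ) • 1 := rfl

theorem commute_timeFamily (a : strongFamilies 𝓗) : Commute (timeFamily 𝓗) a :=
  strongFamilies_ext fun t => by simp [evalAt_timeFamily]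

/-- The family `a'` is the strong derivative of the family `a`. -/
def HasStrongDeriv (a a' : strongFamilies 𝓗) : Prop :=
  ∀ ψ t, HasDerivAt (fun s => evalAt s a ψ) (evalAt t a' ψ) t

theorem HasStrongDeriv.smul {a a' : strongFamilies 𝓗} (c : ℂ) (ha : HasStrongDeriv a a') :
    HasStrongDeriv (c • a) (c • a') := fun ψ t => by
  simpa using (ha ψ t).fun_const_smul c

theorem hasStrongDeriv_const (A : 𝓗 →L[ℂ] 𝓗) : HasStrongDeriv (constFamily A) 0 := fun ψ t => by
  simpa [evalAt_constFamily] using hasDerivAt_const t (A ψ)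

theorem hasStrongDeriv_zero : HasStrongDeriv (0 : strongFamilies 𝓗) 0 := by
  simpa using hasStrongDeriv_const (0 : 𝓗 →L[ℂ] 𝓗)

theorem hasStrongDeriv_timeFamily : HasStrongDeriv (timeFamily 𝓗) 1 := fun ψ t => by
  simpa [evalAt_timeFamily] using (Complex.ofRealCLM.hasDerivAt (x := t)).smul_const ψ

theorem HasStrongDeriv.sub {a a' b b' : strongFamilies 𝓗} (ha : HasStrongDeriv a a')
    (hb : HasStrongDeriv b b') : HasStrongDeriv (a - b) (a' - b') := fun ψ t => by
  simpa using (ha ψ t).fun_sub (hb ψ t)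

theorem HasStrongDeriv.sum {ι : Type*} {s : Finset ι} {a a' : ι → strongFamilies 𝓗}
    (h : ∀ i ∈ s, HasStrongDeriv (a i) (a' i)) :
    HasStrongDeriv (∑ i ∈ s, a i) (∑ i ∈ s, a' i) := fun ψ t => by
  simpa [_root_.sum_apply] using HasDerivAt.fun_sum fun i hi => h i hi ψ t

/-- The Leibniz rule for strong derivatives. -/
theorem HasStrongDeriv.mul {a a' b b' : strongFamilies 𝓗} (ha : HasStrongDeriv a a')
    (hb : HasStrongDeriv b b') : HasStrongDeriv (a * b) (a' * b + a * b') := fun ψ t => by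
  rw [hasDerivAt_iff_tendsto_slope]
  have h1 := hasDerivAt_iff_tendsto_slope.1 (ha (evalAt t b ψ) t)
  have h2 : Tendsto (fun s => evalAt s a (slope (fun s => evalAt s b ψ) t s)) (𝓝[≠] t)
      (𝓝 (evalAt t a (evalAt t b' ψ))) :=
    StronglyContinuous.tendsto_apply a.2 nhdsWithin_le_nhds
      (hasDerivAt_iff_tendsto_slope.1 (hb ψ t))
  have h := h1.add h2
  rw [map_add, map_mul, map_mul]
  refine h.congr fun s => ?_
  have hr : ∀ (r : ℝ) (x : 𝓗), evalAt s a (r • x) = r • evalAt s a x := fun r x =>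
    map_real_smul (evalAt s a) (evalAt s a).continuous r x
  simp only [slope_def_module, hr, ← smul_add, map_sub, map_mul, mul_apply_eq_comp]
  abel_nf

/-- A family with strong derivative zero is constant. -/
theorem HasStrongDeriv.evalAt_eq {a : strongFamilies 𝓗} (ha : HasStrongDeriv a 0) (s t : ℝ) :
    evalAt s a = evalAt t a := by
  ext ψ
  refine is_const_of_deriv_eq_zero (f := fun s => evalAt s a ψ)
    (fun t => (ha ψ t).differentiableAt) (fun t => ?_) s t
  simpa using (ha ψ t).deriv

theorem HasStrongDeriv.eq_of_evalAt_eq {a b c : strongFamilies 𝓗} (ha : HasStrongDeriv a c)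
    (hb : HasStrongDeriv b c) {t : ℝ} (h : evalAt t a = evalAt t b) : a = b := by
  have hd := ha.sub hb
  rw [sub_self] at hd
  refine strongFamilies_ext fun s => ?_
  have := hd.evalAt_eq s t
  rwa [map_sub, map_sub, h, sub_self, sub_eq_zero] at this

theorem strongIntegral_apply {A : ℝ → 𝓗 →L[ℂ] 𝓗} (hA : StronglyContinuous A) (t : ℝ) (ψ : 𝓗) :
    strongIntegral A t ψ = ∫ s in (0 : ℝ)..t, A s ψ :=
  (isStrongIntegral_strongIntegral hA t ψ).2

theorem hasDerivAt_strongIntegral {A : ℝ → 𝓗 →L[ℂ] 𝓗} (hA : StronglyContinuous A) (ψ : 𝓗)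
    (t : ℝ) : HasDerivAt (fun s => strongIntegral A s ψ) (A t ψ) t := by
  simp only [strongIntegral_apply hA]
  exact ((hA ψ).integral_hasStrictDerivAt 0 t).hasDerivAt

theorem StronglyContinuous.strongIntegral {A : ℝ → 𝓗 →L[ℂ] 𝓗} (hA : StronglyContinuous A) :
    StronglyContinuous (strongIntegral A) := fun ψ =>
  continuous_iff_continuousAt.2 fun t => (hasDerivAt_strongIntegral hA ψ t).continuousAt

/-- Integration from `0`, as a linear operator on strongly continuous families. -/
def integralMap : strongFamilies 𝓗 →ₗ[ℂ] strongFamilies 𝓗 where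
  toFun := fun a => ⟨strongIntegral a, StronglyContinuous.strongIntegral a.2⟩
  map_add' := fun a b => by
    refine strongFamilies_ext fun t => ContinuousLinearMap.ext fun ψ => ?_
    change strongIntegral _ t ψ = strongIntegral _ t ψ + strongIntegral _ t ψ
    rw [strongIntegral_apply (a + b).2, strongIntegral_apply a.2, strongIntegral_apply b.2,
      ← intervalIntegral.integral_add ((a.2 ψ).intervalIntegrable _ _)
        ((b.2 ψ).intervalIntegrable _ _)]
    rfl
  map_smul' := fun c a => by
    refine strongFamilies_ext fun t => ContinuousLinearMap.ext fun ψ => ?_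
    change strongIntegral _ t ψ = c • strongIntegral _ t ψ
    rw [strongIntegral_apply (c • a).2, strongIntegral_apply a.2,
      ← intervalIntegral.integral_smul]
    rfl

theorem evalAt_integralMap (t : ℝ) (a : strongFamilies 𝓗) :
    evalAt t (integralMap a) = strongIntegral a t := rfl

theorem hasStrongDeriv_integralMap (a : strongFamilies 𝓗) : HasStrongDeriv (integralMap a) a :=
  hasDerivAt_strongIntegral a.2

theorem evalAt_zero_integralMap (a : strongFamilies 𝓗) : evalAt 0 (integralMap a) = 0 := by
  ext ψ
  rw [evalAt_integralMap, strongIntegral_apply a.2]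
  simp

/-- The fundamental theorem of calculus. -/
theorem HasStrongDeriv.eq_integralMap {a a' : strongFamilies 𝓗} (h : HasStrongDeriv a a')
    (h0 : evalAt 0 a = 0) : a = integralMap a' :=
  h.eq_of_evalAt_eq (hasStrongDeriv_integralMap a') (t := 0) (by rw [h0, evalAt_zero_integralMap])

/-- The coefficients of `f'` are the strong derivatives of the coefficients of `f`. -/
def SeriesDeriv (f f' : (strongFamilies 𝓗)⟦X⟧) : Prop :=
  ∀ n, HasStrongDeriv (coeff n f) (coeff n f')

theorem SeriesDeriv.sub {f f' g g' : (strongFamilies 𝓗)⟦X⟧} (hf : SeriesDeriv f f')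
    (hg : SeriesDeriv g g') : SeriesDeriv (f - g) (f' - g') := fun n => by
  simpa only [map_sub] using (hf n).sub (hg n)

theorem SeriesDeriv.smul {f f' : (strongFamilies 𝓗)⟦X⟧} (c : ℂ) (hf : SeriesDeriv f f') :
    SeriesDeriv (c • f) (c • f') := fun n => (hf n).smul c

theorem SeriesDeriv.mul {f f' g g' : (strongFamilies 𝓗)⟦X⟧} (hf : SeriesDeriv f f')
    (hg : SeriesDeriv g g') : SeriesDeriv (f * g) (f' * g + f * g') := fun n => by
  rw [map_add, coeff_mul, coeff_mul, coeff_mul, ← sum_add_distrib]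
  exact HasStrongDeriv.sum fun p _ => (hf p.1).mul (hg p.2)

/-- The power series whose coefficients are constant families. -/
def constSeries : (𝓗 →L[ℂ] 𝓗)⟦X⟧ →+* (strongFamilies 𝓗)⟦X⟧ :=
  PowerSeries.map (constFamily (𝓗 := 𝓗) : (𝓗 →L[ℂ] 𝓗) →+* strongFamilies 𝓗)

theorem coeff_constSeries (n : ℕ) (f : (𝓗 →L[ℂ] 𝓗)⟦X⟧) :
    coeff n (constSeries f) = constFamily (coeff n f) := rfl

theorem seriesDeriv_constSeries (f : (𝓗 →L[ℂ] 𝓗)⟦X⟧) : SeriesDeriv (constSeries f) 0 := fun n => by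
  simpa [coeff_constSeries] using hasStrongDeriv_const (coeff n f)

theorem SeriesDeriv.lsum {f f' : ℕ → (strongFamilies 𝓗)⟦X⟧} (h : ∀ k, SeriesDeriv (f k) (f' k)) :
    SeriesDeriv (lsum f) (lsum f') := fun n => by
  simp only [FloquetMagnus.lsum, coeff_mk]
  exact HasStrongDeriv.sum fun k _ => h k n

theorem seriesDeriv_one : SeriesDeriv (1 : (strongFamilies 𝓗)⟦X⟧) 0 := by
  simpa using seriesDeriv_constSeries (1 : (𝓗 →L[ℂ] 𝓗)⟦X⟧)

theorem SeriesDeriv.pow {f f' : (strongFamilies 𝓗)⟦X⟧} (h : SeriesDeriv f f') (k : ℕ) :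
    SeriesDeriv (f ^ k) (powDeriv f f' k) := by
  induction k with
  | zero => simpa [powDeriv] using seriesDeriv_one
  | succ k ih =>
    rw [pow_succ', powDeriv, add_comm]
    exact h.mul ih

/-- A criterion for `exp f` to solve the differential equation `Y' = Y x`. -/
theorem SeriesDeriv.psExp {f x : (strongFamilies 𝓗)⟦X⟧} (hf : X ∣ f) (hx : X ∣ x)
    (h : SeriesDeriv f (FloquetMagnus.lsum fun j => bernCoeff j • (adMap f ^ j) x)) :
    SeriesDeriv (psExp f) (psExp f * x) := by
  rw [← lsum_powDeriv hf hx]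
  exact SeriesDeriv.lsum fun k => (h.pow k).smul _

end StrongFamilies

/-! ### The exponential under algebra maps -/

section PsExpMap

variable {R S : Type*} [Ring R] [Algebra ℂ R] [Ring S] [Algebra ℂ S]

theorem map_psExp (φ : R →ₐ[ℂ] S) (f : R⟦X⟧) :
    PowerSeries.map (φ : R →+* S) (psExp f) = psExp (PowerSeries.map (φ : R →+* S) f) := by
  ext n
  simp only [psExp, lsum, coeff_mk, coeff_map, map_sum, coeff_complex_smul, ← map_pow]
  refine sum_congr rfl fun k _ => ?_
  exact map_smul φ _ _

theorem coeff_zero_psExp (f : R⟦X⟧) : coeff 0 (psExp f) = 1 := by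
  simp [psExp, lsum]

end PsExpMap

/-! ### Coefficients of nested commutators -/

section NestedCommutators

variable {R : Type*} [Ring R]

theorem foldr_lie_eq_zero {L : List R} (h : (0 : R) ∈ L) (a : R) :
    L.foldr (fun x y => ⁅x, y⁆) a = 0 := by
  induction L with
  | nil => simp at h
  | cons x L ih =>
    rw [List.foldr_cons]
    rcases List.mem_cons.1 h with h | h
    · rw [← h, Ring.lie_def, zero_mul, mul_zero, sub_zero]
    · rw [ih h, Ring.lie_def, zero_mul, mul_zero, sub_zero]

theorem map_foldr_lie {S : Type*} [Ring S] (φ : R →+* S) (L : List R) (a : R) :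
    φ (L.foldr (fun x y => ⁅x, y⁆) a) = (L.map φ).foldr (fun x y => ⁅x, y⁆) (φ a) := by
  induction L with
  | nil => rfl
  | cons x L ih =>
    rw [List.map_cons, List.foldr_cons, List.foldr_cons, ← ih]
    simp [Ring.lie_def]

theorem sum_antidiagonalTuple_succ {M : Type*} [AddCommMonoid M] (j n : ℕ)
    (F : (Fin (j + 1) → ℕ) → M) :
    ∑ k ∈ Finset.Nat.antidiagonalTuple (j + 1) n, F k =
      ∑ p ∈ antidiagonal n, ∑ k ∈ Finset.Nat.antidiagonalTuple j p.2, F (Fin.cons p.1 k) := by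
  rw [sum_sigma']
  refine sum_bij' (fun k _ => ⟨(k 0, ∑ i, Fin.tail k i), Fin.tail k⟩)
    (fun q _ => Fin.cons q.1.1 q.2) ?_ ?_ ?_ ?_ ?_
  · intro k hk
    rw [Nat.mem_antidiagonalTuple, Fin.sum_univ_succ] at hk
    simpa [Nat.mem_antidiagonalTuple, Fin.tail] using hk
  · rintro ⟨⟨a, b⟩, k⟩ hq
    simp only [mem_sigma, HasAntidiagonal.mem_antidiagonal, Nat.mem_antidiagonalTuple] at hq
    rw [Nat.mem_antidiagonalTuple, Fin.sum_univ_succ]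
    simp [hq.1, hq.2]
  · intro k _
    simp
  · rintro ⟨⟨a, b⟩, k⟩ hq
    simp only [mem_sigma, HasAntidiagonal.mem_antidiagonal, Nat.mem_antidiagonalTuple] at hq
    simp [hq.2]
  · intro k _
    simp

/-- In `coeff_adMap_pow` the tuples with an entry zero may be left out if `f` has no constant
term. -/
theorem sum_antidiagonalTuple_eq_sum_filter {F : ℕ → R} (hF : F 0 = 0) (a : R) (j n : ℕ) :
    ∑ k ∈ Finset.Nat.antidiagonalTuple j n,
      (List.ofFn fun i : Fin j => F (k i)).foldr (fun x y => ⁅x, y⁆) a =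
    ∑ k : Fin j → Fin (n + 1) with (∀ i, 1 ≤ (k i).val) ∧ ∑ i, (k i).val = n,
      (List.ofFn fun i : Fin j => F (k i).val).foldr (fun x y => ⁅x, y⁆) a := by
  symm
  refine sum_of_injOn (fun k i => (k i).val) ?_ ?_ ?_ ?_
  · intro k _ k' _ h
    funext i
    exact Fin.ext (congrFun h i)
  · intro k hk
    simp only [coe_filter, Set.mem_ofPred_eq] at hk
    simpa [Nat.mem_antidiagonalTuple] using hk.2.2
  · intro k hk hk'
    rw [Nat.mem_antidiagonalTuple] at hk
    have : ∃ i, k i = 0 := by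
      by_contra! hne
      refine hk' ⟨fun i => ⟨k i, ?_⟩, ?_, rfl⟩
      · have := single_le_sum (f := k) (fun i _ => Nat.zero_le _) (mem_univ i)
        omega
      · simpa [hk] using fun i => Nat.one_le_iff_ne_zero.2 (hne i)
    obtain ⟨i, hi⟩ := this
    exact foldr_lie_eq_zero (List.mem_ofFn.2 ⟨i, by simp [hi, hF]⟩) a
  · intro k _
    rfl

variable [Algebra ℂ R]

/-- The coefficients of iterated commutators, as sums over all ways to distribute the degree. -/
theorem coeff_adMap_pow (f : R⟦X⟧) (a : R) (j n : ℕ) :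
    coeff n ((adMap f ^ j) (C a)) = ∑ k ∈ Finset.Nat.antidiagonalTuple j n,
      (List.ofFn fun i : Fin j => coeff (k i) f).foldr (fun x y => ⁅x, y⁆) a := by
  induction j generalizing n with
  | zero =>
    rcases n with _ | n
    · simp
    · simp
  | succ j ih =>
    rw [pow_succ', Module.End.mul_apply, adMap_apply, map_sub, coeff_mul, coeff_mul,
      ← Nat.sum_antidiagonal_swap (n := n) (f := fun p => coeff p.1 _ * coeff p.2 f),
      ← sum_sub_distrib, sum_antidiagonalTuple_succ]
    refine sum_congr rfl fun p _ => ?_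
    simp only [Prod.fst_swap, Prod.snd_swap, ih, List.ofFn_succ, Fin.cons_zero, Fin.cons_succ,
      List.foldr_cons, Ring.lie_def, mul_sum, sum_mul, sum_sub_distrib]

end NestedCommutators

/-! ### The Magnus series -/

section MagnusSeries

variable {𝓗 : Type*} [NormedAddCommGroup 𝓗] [InnerProductSpace ℂ 𝓗]

theorem magnusTerm_zero (A : ℝ → 𝓗 →L[ℂ] 𝓗) : magnusTerm A 0 = 0 := by
  rw [magnusTerm, if_pos rfl]

theorem magnusTerm_one (A : ℝ → 𝓗 →L[ℂ] 𝓗) : magnusTerm A 1 = strongIntegral A := by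
  rw [magnusTerm, if_neg one_ne_zero, if_pos rfl]

theorem magnusTerm_add_two (A : ℝ → 𝓗 →L[ℂ] 𝓗) (n : ℕ) (t : ℝ) :
    magnusTerm A (n + 2) t = ∑ j ∈ Finset.Icc 1 (n + 2), bernCoeff j •
      ∑ k : Fin j → Fin (n + 2) with (∀ i, 1 ≤ (k i).val) ∧ ∑ i, (k i).val = n + 1,
        strongIntegral (fun τ => (List.ofFn fun i : Fin j =>
          magnusTerm A (k i).val τ).foldr (fun X Y => ⁅X, Y⁆) (A τ)) t := by
  rw [magnusTerm, if_neg (by omega), if_neg (by omega)]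
  rfl

theorem StronglyContinuous.rescale {H : ℝ → 𝓗 →L[ℂ] 𝓗} (hH : StronglyContinuous H) (T : ℝ) :
    StronglyContinuous (rescale H T) := fun ψ => (hH ψ).comp (continuous_id.div_const T)

variable [CompleteSpace 𝓗]

theorem StronglyContinuous.foldr_lie {A : ℝ → 𝓗 →L[ℂ] 𝓗} (hA : StronglyContinuous A) {j : ℕ}
    {B : Fin j → ℝ → 𝓗 →L[ℂ] 𝓗} (hB : ∀ i, StronglyContinuous (B i)) :
    StronglyContinuous fun τ =>
      (List.ofFn fun i : Fin j => B i τ).foldr (fun X Y => ⁅X, Y⁆) (A τ) := by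
  induction j with
  | zero => simpa using hA
  | succ j ih =>
    simp only [List.ofFn_succ, List.foldr_cons, Ring.lie_def]
    have h := ih fun i => hB i.succ
    exact fun ψ => ((hB 0).mul h ψ).sub (h.mul (hB 0) ψ)

theorem StronglyContinuous.magnusTerm {A : ℝ → 𝓗 →L[ℂ] 𝓗} (hA : StronglyContinuous A) (l : ℕ) :
    StronglyContinuous (magnusTerm A l) := by
  induction l using Nat.strong_induction_on with
  | _ l ih =>
    rcases l with _ | _ | n
    · rw [magnusTerm_zero]
      exact fun _ => continuous_const
    · rw [zero_add, magnusTerm_one]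
      exact hA.strongIntegral
    · intro ψ
      simp only [magnusTerm_add_two, _root_.sum_apply, _root_.smul_apply]
      refine continuous_finsetSum _ fun j _ => (continuous_finsetSum _ fun k _ => ?_).const_smul _
      exact (hA.foldr_lie fun i => ih _ (k i).isLt).strongIntegral ψ

/-- The terms of the Magnus series as members of the algebra of strongly continuous families. -/
def magnusFamily (a : strongFamilies 𝓗) (l : ℕ) : strongFamilies 𝓗 :=
  ⟨magnusTerm a l, StronglyContinuous.magnusTerm a.2 l⟩

theorem evalAt_magnusFamily (a : strongFamilies 𝓗) (l : ℕ) (t : ℝ) :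
    evalAt t (magnusFamily a l) = magnusTerm a l t := rfl

/-- The Magnus series, with one power of the formal variable for each factor `a`. -/
def magnusSeries (a : strongFamilies 𝓗) : (strongFamilies 𝓗)⟦X⟧ :=
  PowerSeries.mk (magnusFamily a)

theorem magnusFamily_zero (a : strongFamilies 𝓗) : magnusFamily a 0 = 0 :=
  Subtype.ext (magnusTerm_zero (a : ℝ → 𝓗 →L[ℂ] 𝓗))

theorem X_dvd_magnusSeries (a : strongFamilies 𝓗) : X ∣ magnusSeries a := by
  rw [X_dvd_iff, magnusSeries, constantCoeff_mk, magnusFamily_zero]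

theorem magnusFamily_one (a : strongFamilies 𝓗) : magnusFamily a 1 = integralMap a :=
  Subtype.ext (magnusTerm_one (a : ℝ → 𝓗 →L[ℂ] 𝓗))

theorem magnusFamily_add_two (a : strongFamilies 𝓗) (n : ℕ) :
    magnusFamily a (n + 2) = integralMap (∑ j ∈ Finset.Icc 1 (n + 2), bernCoeff j •
      coeff (n + 1) ((adMap (magnusSeries a) ^ j) (C a))) := by
  refine strongFamilies_ext fun t => ?_
  rw [evalAt_magnusFamily, magnusTerm_add_two, map_sum, map_sum]
  refine sum_congr rfl fun j _ => ?_
  rw [coeff_adMap_pow, map_smul, map_smul]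
  simp only [magnusSeries, coeff_mk]
  rw [sum_antidiagonalTuple_eq_sum_filter (magnusFamily_zero a), map_sum, map_sum]
  congr 1
  refine sum_congr rfl fun k _ => ?_
  rw [evalAt_integralMap]
  congr 1
  funext τ
  have := map_foldr_lie (evalAt τ : strongFamilies 𝓗 →ₐ[ℂ] (𝓗 →L[ℂ] 𝓗)).toRingHom
    (List.ofFn fun i : Fin j => magnusFamily a (k i).val) a
  rw [List.map_ofFn] at this
  exact this.symm

theorem adMap_pow_X_mul {R : Type*} [Ring R] [Algebra ℂ R] (f g : R⟦X⟧) (j : ℕ) :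
    (adMap f ^ j) (X * g) = X * (adMap f ^ j) g := by
  induction j with
  | zero => simp
  | succ j ih =>
    rw [pow_succ', Module.End.mul_apply, ih, Module.End.mul_apply, adMap_apply, adMap_apply,
      mul_sub, ← mul_assoc, (commute_X f).eq]
    simp only [mul_assoc]

/-- The differential equation of the Magnus series. -/
theorem seriesDeriv_magnusSeries (a : strongFamilies 𝓗) :
    SeriesDeriv (magnusSeries a)
      (lsum fun j => bernCoeff j • (adMap (magnusSeries a) ^ j) (X * C a)) := by
  have hfam : ∀ j, X ^ j ∣ bernCoeff j • (adMap (magnusSeries a) ^ j) (X * C a) := fun j =>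
    X_pow_dvd_smul _ (X_pow_dvd_adMap_pow (n := 0) (X_dvd_magnusSeries a) (by simp) j)
  have hcoeff : ∀ j n, coeff (n + 1) (bernCoeff j • (adMap (magnusSeries a) ^ j) (X * C a)) =
      bernCoeff j • coeff n ((adMap (magnusSeries a) ^ j) (C a)) := by
    intro j n
    rw [adMap_pow_X_mul, coeff_complex_smul, coeff_succ_X_mul]
  intro n
  rcases n with _ | _ | n
  · have h0 : coeff 0 (lsum fun j => bernCoeff j • (adMap (magnusSeries a) ^ j) (X * C a)) = 0 := by
      rw [coeff_lsum hfam zero_lt_one, sum_range_one, pow_zero, Module.End.one_apply,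
        coeff_complex_smul, coeff_zero_X_mul, smul_zero]
    rw [h0, magnusSeries, coeff_mk, magnusFamily_zero]
    exact hasStrongDeriv_zero
  · have h1 : coeff (0 + 1) (lsum fun j =>
        bernCoeff j • (adMap (magnusSeries a) ^ j) (X * C a)) = a := by
      rw [coeff_lsum hfam (show 0 + 1 < 2 by omega), sum_range_succ, sum_range_one, hcoeff, hcoeff,
        coeff_adMap_pow _ _ 1]
      simp only [magnusSeries, coeff_mk]
      rw [Nat.antidiagonalTuple_one, sum_singleton]
      simp [magnusFamily_zero, bernCoeff, Ring.lie_def]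
    rw [h1, magnusSeries, coeff_mk, zero_add, magnusFamily_one]
    exact hasStrongDeriv_integralMap a
  · have h2 : coeff (n + 1 + 1) (lsum fun j =>
        bernCoeff j • (adMap (magnusSeries a) ^ j) (X * C a)) =
        ∑ j ∈ Finset.Icc 1 (n + 2), bernCoeff j •
          coeff (n + 1) ((adMap (magnusSeries a) ^ j) (C a)) := by
      -- The summand `j = 0` contributes only to the coefficient of `X`.
      rw [coeff_lsum hfam (show n + 1 + 1 < n + 2 + 1 by omega)]
      simp only [hcoeff]
      rw [range_eq_Ico, sum_eq_sum_Ico_succ_bot (by omega), pow_zero, Module.End.one_apply,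
        coeff_succ_C, smul_zero, zero_add]
      rfl
    rw [h2, magnusSeries, coeff_mk, magnusFamily_add_two]
    exact hasStrongDeriv_integralMap _

/-- Change of variables: rescaling time by `T` produces a factor `T`. -/
theorem strongIntegral_mul_left {A B : ℝ → 𝓗 →L[ℂ] 𝓗} (hA : StronglyContinuous A)
    (hB : StronglyContinuous B) (T : ℝ) (c : ℂ) (h : ∀ s, B (T * s) = c • A s) (u : ℝ) :
    strongIntegral B (T * u) = ((T : ℂ) * c) • strongIntegral A u := by
  ext ψ
  rw [_root_.smul_apply, strongIntegral_apply hA, strongIntegral_apply hB]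
  have := intervalIntegral.smul_integral_comp_mul_left (fun s => B s ψ) T (a := 0) (b := u)
  rw [mul_zero] at this
  rw [← this]
  simp only [h, _root_.smul_apply, intervalIntegral.integral_smul]
  rw [mul_smul, Complex.coe_smul]

/-- Nested commutators are linear in every entry. -/
theorem foldr_lie_smul {R : Type*} [Ring R] [Algebra ℂ R] {j : ℕ} (c : Fin j → ℂ) (x : Fin j → R)
    (a : R) : (List.ofFn fun i => c i • x i).foldr (fun x y => ⁅x, y⁆) a =
      (∏ i, c i) • (List.ofFn x).foldr (fun x y => ⁅x, y⁆) a := by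
  induction j with
  | zero => simp
  | succ j ih =>
    rw [List.ofFn_succ, List.ofFn_succ, List.foldr_cons, List.foldr_cons,
      ih (fun i => c i.succ) fun i => x i.succ, Fin.prod_univ_succ, Ring.lie_def, Ring.lie_def]
    simp only [smul_mul_smul_comm, smul_sub]
    rw [mul_comm (∏ i : Fin j, _)]

/-- The `l`-th Magnus term is homogeneous of degree `l` under a rescaling of time. -/
theorem magnusTerm_mul_left {A B : ℝ → 𝓗 →L[ℂ] 𝓗} (hA : StronglyContinuous A)
    (hB : StronglyContinuous B) {T : ℝ} (h : ∀ s, B (T * s) = A s) (l : ℕ) (u : ℝ) :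
    magnusTerm B l (T * u) = ((T : ℂ) ^ l) • magnusTerm A l u := by
  induction l using Nat.strong_induction_on generalizing u with
  | _ l ih =>
    rcases l with _ | _ | n
    · simp [magnusTerm_zero]
    · rw [zero_add, magnusTerm_one, magnusTerm_one,
        strongIntegral_mul_left hA hB T 1 (by simpa using h), mul_one, pow_one]
    · rw [magnusTerm_add_two, magnusTerm_add_two, Finset.smul_sum]
      refine sum_congr rfl fun j _ => ?_
      rw [smul_comm]
      congr 1
      rw [Finset.smul_sum]
      refine sum_congr rfl fun k hk => ?_
      rw [mem_filter] at hk
      rw [strongIntegral_mul_left (hA.foldr_lie fun i => hA.magnusTerm (k i).val)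
        (hB.foldr_lie fun i => hB.magnusTerm (k i).val) T ((T : ℂ) ^ (n + 1)), ← pow_succ']
      intro s
      have hi : ∀ i : Fin j, magnusTerm B (k i).val (T * s) =
          ((T : ℂ) ^ (k i).val) • magnusTerm A (k i).val s := fun i => ih _ (k i).isLt s
      simp only [hi, h]
      rw [foldr_lie_smul (fun i => (T : ℂ) ^ (k i).val), prod_pow_eq_pow_sum, hk.2.2]

theorem star_foldr_lie {R : Type*} [Ring R] [StarRing R] {j : ℕ} {x : Fin j → R} {a : R}
    (hx : ∀ i, star (x i) = -x i) (ha : star a = -a) :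
    star ((List.ofFn x).foldr (fun x y => ⁅x, y⁆) a) =
      -(List.ofFn x).foldr (fun x y => ⁅x, y⁆) a := by
  induction j with
  | zero => simpa using ha
  | succ j ih =>
    rw [List.ofFn_succ, List.foldr_cons, Ring.lie_def, star_sub, star_mul, star_mul, hx 0,
      ih fun i => hx i.succ]
    noncomm_ring

theorem star_strongIntegral {A : ℝ → 𝓗 →L[ℂ] 𝓗} (hA : StronglyContinuous A)
    (h : ∀ s, star (A s) = -A s) (t : ℝ) : star (strongIntegral A t) = -strongIntegral A t := by
  have hint : ∀ ψ, IntervalIntegrable (fun s => A s ψ) MeasureTheory.volume 0 t :=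
    fun ψ => (hA ψ).intervalIntegrable 0 t
  have hleft : ∀ φ ψ : 𝓗, inner ℂ φ (strongIntegral A t ψ) =
      ∫ s in (0 : ℝ)..t, inner ℂ φ (A s ψ) := fun φ ψ => by
    rw [strongIntegral_apply hA]
    exact ((innerSL ℂ φ).intervalIntegral_comp_comm (hint ψ)).symm
  have hconj : ∀ f : ℝ → ℂ, (starRingEnd ℂ) (∫ s in (0 : ℝ)..t, f s) =
      ∫ s in (0 : ℝ)..t, (starRingEnd ℂ) (f s) := fun f => by
    simp only [intervalIntegral, map_sub, integral_conj]
  ext φ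
  refine ext_inner_right ℂ fun ψ => ?_
  rw [ContinuousLinearMap.star_eq_adjoint, ContinuousLinearMap.adjoint_inner_left, hleft,
    _root_.neg_apply, inner_neg_left, ← inner_conj_symm, hleft,
    hconj, ← intervalIntegral.integral_neg]
  refine intervalIntegral.integral_congr fun s _ => ?_
  simp only [inner_conj_symm]
  rw [← ContinuousLinearMap.adjoint_inner_left, ← ContinuousLinearMap.star_eq_adjoint, h,
    _root_.neg_apply, inner_neg_left]

/-- The Magnus terms of a skew-adjoint family are skew-adjoint: real combinations, nested
commutators and integrals preserve skew-adjointness. -/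
theorem star_magnusTerm {A : ℝ → 𝓗 →L[ℂ] 𝓗} (hA : StronglyContinuous A)
    (h : ∀ s, star (A s) = -A s) (l : ℕ) (t : ℝ) :
    star (magnusTerm A l t) = -magnusTerm A l t := by
  induction l using Nat.strong_induction_on generalizing t with
  | _ l ih =>
    rcases l with _ | _ | n
    · simp [magnusTerm_zero]
    · rw [zero_add, magnusTerm_one, star_strongIntegral hA h]
    · rw [magnusTerm_add_two, star_sum, ← sum_neg_distrib]
      refine sum_congr rfl fun j _ => ?_
      have hb : star (bernCoeff j) = bernCoeff j := by simp [bernCoeff]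
      rw [star_smul, hb, star_sum, ← smul_neg, ← sum_neg_distrib]
      congr 1
      refine sum_congr rfl fun k _ => ?_
      refine star_strongIntegral (hA.foldr_lie fun i => hA.magnusTerm (k i).val) (fun s => ?_) t
      exact star_foldr_lie (fun i => ih _ (k i).isLt s) (h s)

end MagnusSeries

/-! ### The formal equation of the effective Hamiltonian -/

section EffectiveSeries

variable {𝓗 : Type*} [NormedAddCommGroup 𝓗] [InnerProductSpace ℂ 𝓗] [CompleteSpace 𝓗]

theorem hasStrongDeriv_timeFamily_mul (A : 𝓗 →L[ℂ] 𝓗) :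
    HasStrongDeriv (timeFamily 𝓗 * constFamily A) (constFamily A) := by
  have h := hasStrongDeriv_timeFamily.mul (hasStrongDeriv_const A)
  rwa [one_mul, mul_zero, add_zero] at h

/-- The values at time `t` of a series of families. -/
def evalSeries (t : ℝ) : (strongFamilies 𝓗)⟦X⟧ →+* (𝓗 →L[ℂ] 𝓗)⟦X⟧ :=
  PowerSeries.map (evalAt t : strongFamilies 𝓗 →ₐ[ℂ] (𝓗 →L[ℂ] 𝓗)).toRingHom

theorem coeff_evalSeries (t : ℝ) (n : ℕ) (f : (strongFamilies 𝓗)⟦X⟧) :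
    coeff n (evalSeries t f) = evalAt t (coeff n f) := rfl

theorem evalSeries_psExp (t : ℝ) (f : (strongFamilies 𝓗)⟦X⟧) :
    evalSeries t (psExp f) = psExp (evalSeries t f) :=
  map_psExp (evalAt t : strongFamilies 𝓗 →ₐ[ℂ] (𝓗 →L[ℂ] 𝓗)) f

/-- The formal iterated actions for period `1`, formed with a formal constant Hamiltonian `E` on the
left and the family `h` on the right. -/
def iterSeries (E : (𝓗 →L[ℂ] 𝓗)⟦X⟧) (h : strongFamilies 𝓗) : ℕ → (strongFamilies 𝓗)⟦X⟧
  | 0 => 1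
  | j + 1 => PowerSeries.mk fun n =>
      integralMap (coeff n (constSeries E * iterSeries E h j - iterSeries E h j * C h)) -
        timeFamily 𝓗 * constFamily (evalAt 1 (integralMap
          (coeff n (constSeries E * iterSeries E h j - iterSeries E h j * C h))))

/-- The formal averages of `E S_j - S_j h` over one period. -/
def meanSeries (E : (𝓗 →L[ℂ] 𝓗)⟦X⟧) (h : strongFamilies 𝓗) (j : ℕ) : (𝓗 →L[ℂ] 𝓗)⟦X⟧ :=
  PowerSeries.mk fun n => evalAt 1 (integralMap
    (coeff n (constSeries E * iterSeries E h j - iterSeries E h j * C h)))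

theorem seriesDeriv_iterSeries_succ (E : (𝓗 →L[ℂ] 𝓗)⟦X⟧) (h : strongFamilies 𝓗) (j : ℕ) :
    SeriesDeriv (iterSeries E h (j + 1)) (constSeries E * iterSeries E h j -
      iterSeries E h j * C h - constSeries (meanSeries E h j)) := by
  intro n
  have h1 := (hasStrongDeriv_integralMap
    (coeff n (constSeries E * iterSeries E h j - iterSeries E h j * C h))).sub
    (hasStrongDeriv_timeFamily_mul (coeff n (meanSeries E h j)))
  rw [← coeff_constSeries n (meanSeries E h j), ← map_sub] at h1
  rw [iterSeries, coeff_mk]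
  rw [coeff_constSeries, meanSeries, coeff_mk] at h1
  exact h1

theorem evalAt_zero_iterSeries_succ (E : (𝓗 →L[ℂ] 𝓗)⟦X⟧) (h : strongFamilies 𝓗) (j n : ℕ) :
    evalAt 0 (coeff n (iterSeries E h (j + 1))) = 0 := by
  rw [iterSeries, coeff_mk, map_sub, map_mul, evalAt_zero_integralMap, evalAt_timeFamily]
  simp

/-- The subtracted average makes the iterated actions vanish at the end of the period. -/
theorem evalAt_one_iterSeries_succ (E : (𝓗 →L[ℂ] 𝓗)⟦X⟧) (h : strongFamilies 𝓗) (j n : ℕ) :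
    evalAt 1 (coeff n (iterSeries E h (j + 1))) = 0 := by
  rw [iterSeries, coeff_mk, map_sub, map_mul, evalAt_timeFamily, evalAt_constFamily]
  simp

/-- The generating series `∑ (-iX)^j S_j` of the iterated actions. -/
def iterGen (E : (𝓗 →L[ℂ] 𝓗)⟦X⟧) (h : strongFamilies 𝓗) : (strongFamilies 𝓗)⟦X⟧ :=
  lsum fun j => (-Complex.I) ^ j • (X ^ j * iterSeries E h j)

/-- The generating series `∑ (-iX)^j ⟨E S_j - S_j h⟩`. -/
def meanGen (E : (𝓗 →L[ℂ] 𝓗)⟦X⟧) (h : strongFamilies 𝓗) : (𝓗 →L[ℂ] 𝓗)⟦X⟧ :=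
  lsum fun j => (-Complex.I) ^ j • (X ^ j * meanSeries E h j)

theorem X_pow_dvd_smul_X_pow_mul {R : Type*} [Ring R] [Algebra ℂ R] (c : ℂ) (j : ℕ) (f : R⟦X⟧) :
    X ^ j ∣ c • (X ^ j * f) :=
  X_pow_dvd_smul c (Dvd.intro f rfl)

theorem coeff_zero_iterGen (E : (𝓗 →L[ℂ] 𝓗)⟦X⟧) (h : strongFamilies 𝓗) :
    coeff 0 (iterGen E h) = 1 := by
  simp [iterGen, lsum, iterSeries]

/-- At the ends of the period only the first iterated action survives. -/
theorem evalSeries_iterGen (E : (𝓗 →L[ℂ] 𝓗)⟦X⟧) (h : strongFamilies 𝓗) {t : ℝ}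
    (ht : ∀ j n, evalAt t (coeff n (iterSeries E h (j + 1))) = 0) :
    evalSeries t (iterGen E h) = 1 := by
  ext1 n
  rw [coeff_evalSeries, iterGen, lsum, coeff_mk, map_sum, sum_eq_single 0]
  · rw [pow_zero, pow_zero, one_smul, one_mul, iterSeries, coeff_one, coeff_one]
    split_ifs <;> simp
  · intro j _ hj
    obtain ⟨j, rfl⟩ := Nat.exists_eq_succ_of_ne_zero hj
    rw [coeff_complex_smul, coeff_X_pow_mul']
    split_ifs with hjn
    · have : evalAt t ((-Complex.I) ^ j.succ • coeff (n - j.succ) (iterSeries E h j.succ)) = 0 := by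
        rw [map_smul, ht, smul_zero]
      exact this
    · simp
  · simp

theorem constSeries_lsum {f : ℕ → (𝓗 →L[ℂ] 𝓗)⟦X⟧} :
    constSeries (lsum f) = lsum fun k => constSeries (f k) := by
  ext1 n
  simp only [coeff_constSeries, lsum, coeff_mk, map_sum]

theorem smul_X_pow_identity {A : Type*} [Ring A] [Algebra ℂ A] {x e : A} (he : e * x = x * e)
    (s h m : A) (c : ℂ) (j : ℕ) :
    x * (c • (e * (c ^ j • (x ^ j * s)) - c ^ j • (x ^ j * s) * h - c ^ j • (x ^ j * m))) =
      c ^ (j + 1) • (x ^ (j + 1) * (e * s - s * h - m)) := by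
  have he' : e * (x ^ j * s) = x ^ j * (e * s) := by
    rw [← mul_assoc, (Commute.pow_right (show Commute e x from he) j).eq, mul_assoc]
  rw [mul_smul_comm, mul_smul_comm, he', smul_mul_assoc, mul_assoc, ← smul_sub, ← smul_sub,
    ← mul_sub, ← mul_sub, mul_smul_comm, smul_smul, ← pow_succ', ← mul_assoc, ← pow_succ']

/-- The sum of the equations `S_{j+1}' = E S_j - S_j h - ⟨E S_j - S_j h⟩`. -/
theorem seriesDeriv_iterGen (E : (𝓗 →L[ℂ] 𝓗)⟦X⟧) (h : strongFamilies 𝓗) :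
    SeriesDeriv (iterGen E h) ((-Complex.I) • (X * (constSeries E * iterGen E h -
      iterGen E h * C h - constSeries (meanGen E h)))) := by
  let d : ℕ → (strongFamilies 𝓗)⟦X⟧ := fun j => constSeries E * iterSeries E h j -
    iterSeries E h j * C h - constSeries (meanSeries E h j)
  let d' : ℕ → (strongFamilies 𝓗)⟦X⟧ := fun j =>
    Nat.casesOn j 0 fun j => (-Complex.I) ^ (j + 1) • (X ^ (j + 1) * d j)
  have h1 : SeriesDeriv (iterGen E h) (lsum d') := by
    refine SeriesDeriv.lsum fun j => ?_
    rcases j with _ | j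
    · simpa [iterSeries, d'] using seriesDeriv_one (𝓗 := 𝓗)
    · refine SeriesDeriv.smul _ ?_
      have hX : SeriesDeriv ((X : (strongFamilies 𝓗)⟦X⟧) ^ (j + 1)) 0 := by
        simpa [constSeries] using seriesDeriv_constSeries ((X : (𝓗 →L[ℂ] 𝓗)⟦X⟧) ^ (j + 1))
      simpa using hX.mul (seriesDeriv_iterSeries_succ E h j)
  have hd' : ∀ j, X ^ j ∣ d' j := by
    rintro (_ | j)
    · simp
    · exact X_pow_dvd_smul_X_pow_mul _ _ _
  convert h1
  have hf := fun j => X_pow_dvd_smul_X_pow_mul ((-Complex.I) ^ j) j (iterSeries E h j)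
  have hg : ∀ j, X ^ j ∣ constSeries ((-Complex.I) ^ j • (X ^ j * meanSeries E h j)) := by
    intro j
    obtain ⟨g, hg⟩ := X_pow_dvd_smul_X_pow_mul ((-Complex.I) ^ j) j (meanSeries E h j)
    rw [hg, map_mul]
    exact ⟨constSeries g, by simp [constSeries]⟩
  rw [iterGen, meanGen, mul_lsum hf, lsum_mul hf, constSeries_lsum]
  ext1 n
  rcases n with _ | n
  · rw [coeff_complex_smul, coeff_zero_X_mul, smul_zero, coeff_lsum hd' zero_lt_one]
    simp [d']
  · rw [coeff_complex_smul, coeff_succ_X_mul, coeff_lsum hd' (Nat.lt_succ_self _), sum_range_succ']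
    simp only [lsum, map_sub, coeff_mk, ← sum_sub_distrib]
    rw [Finset.smul_sum]
    have hd0 : d' 0 = 0 := rfl
    have hds : ∀ j, d' (j + 1) = (-Complex.I) ^ (j + 1) • (X ^ (j + 1) * d j) := fun _ => rfl
    simp only [hd0, hds, map_zero, add_zero, d]
    refine sum_congr rfl fun j _ => ?_
    have hc : ∀ m : (𝓗 →L[ℂ] 𝓗)⟦X⟧, constSeries ((-Complex.I) ^ j • (X ^ j * m)) =
        (-Complex.I) ^ j • (X ^ j * constSeries m) := by
      intro m
      have h1 : ∀ (c : ℂ) (f : (𝓗 →L[ℂ] 𝓗)⟦X⟧), constSeries (c • f) = c • constSeries f := by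
        intro c f
        ext1 n
        rw [coeff_constSeries, coeff_complex_smul, coeff_complex_smul, map_smul, coeff_constSeries]
      rw [h1, map_mul]
      simp [constSeries]
    rw [hc, ← map_sub, ← map_sub, ← coeff_complex_smul, ← coeff_succ_X_mul,
      smul_X_pow_identity (commute_X (constSeries E))]

variable (𝓗) in
theorem commute_C_timeFamily (f : (strongFamilies 𝓗)⟦X⟧) : Commute (C (timeFamily 𝓗)) f := by
  ext1 n
  rw [coeff_C_mul, coeff_mul_C]
  exact commute_timeFamily _

/-- The family `t ↦ exp (t w)` satisfies `G' = G w`. -/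
theorem seriesDeriv_psExp_timeFamily_mul {w : (𝓗 →L[ℂ] 𝓗)⟦X⟧} (hw : X ∣ w) :
    SeriesDeriv (psExp (C (timeFamily 𝓗) * constSeries w))
      (psExp (C (timeFamily 𝓗) * constSeries w) * constSeries w) := by
  have hw' : X ∣ constSeries w := by
    obtain ⟨g, rfl⟩ := hw
    exact ⟨constSeries g, by simp [constSeries]⟩
  have hf : X ∣ C (timeFamily 𝓗) * constSeries w := by
    simpa using X_pow_dvd_mul_left (n := 1) (C (timeFamily 𝓗)) (by simpa using hw')
  refine SeriesDeriv.psExp hf hw' ?_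
  have had : adMap (C (timeFamily 𝓗) * constSeries w) (constSeries w) = 0 := by
    rw [adMap_apply, mul_assoc, (commute_C_timeFamily 𝓗 _).eq, mul_assoc,
      (commute_C_timeFamily 𝓗 _).eq, sub_self]
  have hl : lsum (fun j => bernCoeff j •
      (adMap (C (timeFamily 𝓗) * constSeries w) ^ j) (constSeries w)) = constSeries w := by
    ext1 n
    rw [lsum, coeff_mk, sum_eq_single 0]
    · have hb : bernCoeff 0 = 1 := by simp [bernCoeff]
      rw [hb, one_smul, pow_zero, Module.End.one_apply]
    · intro j _ hj
      obtain ⟨j, rfl⟩ := Nat.exists_eq_succ_of_ne_zero hj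
      rw [pow_succ, Module.End.mul_apply, had, map_zero, smul_zero, map_zero]
    · intro hn
      exact absurd (mem_range.2 n.succ_pos) hn
  rw [hl]
  intro n
  rw [coeff_C_mul]
  exact hasStrongDeriv_timeFamily_mul (coeff n w)

theorem evalAt_zero_magnusFamily (a : strongFamilies 𝓗) (l : ℕ) :
    evalAt 0 (magnusFamily a l) = 0 := by
  rcases l with _ | _ | n
  · rw [magnusFamily_zero, map_zero]
  · rw [zero_add, magnusFamily_one, evalAt_zero_integralMap]
  · rw [magnusFamily_add_two, evalAt_zero_integralMap]

/-- The formal Floquet-Magnus Hamiltonian for period `1`. -/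
def floquetSeries (h : strongFamilies 𝓗) : (𝓗 →L[ℂ] 𝓗)⟦X⟧ :=
  PowerSeries.mk fun n => (-Complex.I) • evalAt 1 (magnusFamily (Complex.I • h) (n + 1))

theorem coeff_floquetSeries (h : strongFamilies 𝓗) (n : ℕ) : coeff n (floquetSeries h) =
    (-Complex.I) • evalAt 1 (magnusFamily (Complex.I • h) (n + 1)) := by
  rw [floquetSeries, coeff_mk]

/-- The value of the Magnus series after one period is `i X` times the formal Floquet-Magnus
Hamiltonian. -/
theorem smul_X_mul_floquetSeries (h : strongFamilies 𝓗) :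
    Complex.I • (X * floquetSeries h) = evalSeries 1 (magnusSeries (Complex.I • h)) := by
  ext1 n
  rw [coeff_evalSeries, magnusSeries, coeff_mk, coeff_complex_smul]
  rcases n with _ | n
  · rw [coeff_zero_X_mul, magnusFamily_zero, map_zero, smul_zero]
  · rw [coeff_succ_X_mul, coeff_floquetSeries, smul_smul, mul_neg, Complex.I_mul_I, neg_neg,
      one_smul]

/-- In the equation `Z' = X (Z a + i G k)`, with `G = 1 + O(X)` and `k` constant in time, the values
`Z(0) = Z(1) = 0` force `k = 0`: the lowest coefficient of `k` is the increment over one period of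
the next coefficient of `Z`. -/
theorem eq_zero_of_seriesDeriv {Z G : (strongFamilies 𝓗)⟦X⟧} {k : (𝓗 →L[ℂ] 𝓗)⟦X⟧}
    {a : strongFamilies 𝓗}
    (hZ' : SeriesDeriv Z (X * (Z * C a + Complex.I • (G * constSeries k))))
    (hG : coeff 0 G = 1) (hZ : coeff 0 Z = 0) (hZ0 : evalSeries 0 Z = 0)
    (hZ1 : evalSeries 1 Z = 0) : k = 0 := by
  have hZ0n : ∀ n, evalAt 0 (coeff n Z) = 0 := fun n => by
    rw [← coeff_evalSeries, hZ0, map_zero]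
  have hZ1n : ∀ n, evalAt 1 (coeff n Z) = 0 := fun n => by
    rw [← coeff_evalSeries, hZ1, map_zero]
  have hmain : ∀ n, coeff n Z = 0 ∧ ∀ m < n, coeff m k = 0 := by
    intro n
    induction n with
    | zero => exact ⟨hZ, fun m hm => absurd hm (Nat.not_lt_zero m)⟩
    | succ n ih =>
      have hd := hZ' (n + 1)
      have hc : coeff (n + 1) (X * (Z * C a + Complex.I • (G * constSeries k))) =
          constFamily (Complex.I • coeff n k) := by
        rw [coeff_succ_X_mul, map_add, coeff_mul_C, ih.1, zero_mul, zero_add, coeff_complex_smul,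
          coeff_mul, sum_eq_single (0, n)]
        · rw [hG, one_mul, coeff_constSeries, map_smul]
        · rintro ⟨p, q⟩ hp hne
          rw [HasAntidiagonal.mem_antidiagonal] at hp
          have hq : q < n := by
            rcases Nat.lt_or_ge q n with hq | hq
            · exact hq
            · exact absurd (Prod.ext (by simp at hp ⊢; omega) (by simp at hp ⊢; omega)) hne
          rw [coeff_constSeries, ih.2 q hq, map_zero, mul_zero]
        · intro hn
          exact absurd (HasAntidiagonal.mem_antidiagonal.2 (zero_add n)) hn
      rw [hc] at hd
      have heq := hd.eq_of_evalAt_eq (hasStrongDeriv_timeFamily_mul _) (t := 0) (by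
        rw [hZ0n, map_mul, evalAt_timeFamily, Complex.ofReal_zero, zero_smul, zero_mul])
      have hkn : coeff n k = 0 := by
        have := hZ1n (n + 1)
        rw [heq, map_mul, evalAt_timeFamily, evalAt_constFamily, Complex.ofReal_one, one_smul,
          one_mul] at this
        exact (smul_eq_zero.1 this).resolve_left Complex.I_ne_zero
      refine ⟨by rw [heq, hkn, smul_zero, map_zero, mul_zero], fun m hm => ?_⟩
      rcases Nat.lt_succ_iff_lt_or_eq.1 hm with h | rfl
      · exact ih.2 m h
      · exact hkn
  ext1 n
  rw [(hmain (n + 1)).2 n n.lt_succ_self, map_zero]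

/-- The algebra behind the differential equation of `Z = G * iterGen - Y`: here `x` is the formal
variable, `G' = G (i x c)`, `iterGen' = -i x (c * iterGen - iterGen * h - k)`, `Y' = Y (i x h)`. -/
theorem leibniz_identity {A : Type*} [Ring A] [Algebra ℂ A] {x g y : A} (hg : g * x = x * g)
    (hy : y * x = x * y) (q c h k : A) :
    x * ((g * q - y) * (Complex.I • h) + Complex.I • (g * k)) =
      g * (Complex.I • (x * c)) * q + g * ((-Complex.I) • (x * (c * q - q * h - k))) -
        y * (x * (Complex.I • h)) := by
  have hg' : ∀ z, g * (x * z) = x * (g * z) := fun z => by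
    rw [← mul_assoc, hg, mul_assoc]
  have hy' : ∀ z, y * (x * z) = x * (y * z) := fun z => by
    rw [← mul_assoc, hy, mul_assoc]
  simp only [mul_smul_comm, smul_mul_assoc, neg_smul, mul_neg, mul_assoc, mul_sub, sub_mul,
    mul_add, smul_sub, hg', hy']
  abel

/-- The formal Floquet-Magnus Hamiltonian solves the equation which defines the effective
Hamiltonians. With `G = exp (t Ω(1))` and `Y = exp (Ω(t))`, the series `Z = G * iterGen - Y`
vanishes at `t = 0` and `t = 1`, and `eq_zero_of_seriesDeriv` applies to it. -/
theorem meanGen_floquetSeries (h : strongFamilies 𝓗) : meanGen (floquetSeries h) h = 0 := by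
  set E := floquetSeries h
  set a : strongFamilies 𝓗 := Complex.I • h with ha
  set w : (𝓗 →L[ℂ] 𝓗)⟦X⟧ := Complex.I • (X * E) with hw
  have hw1 : w = evalSeries 1 (magnusSeries a) := smul_X_mul_floquetSeries h
  have hXw : X ∣ w := by
    rw [X_dvd_iff, ← coeff_zero_eq_constantCoeff_apply, hw, coeff_complex_smul, coeff_zero_X_mul,
      smul_zero]
  have hcw : constSeries w = Complex.I • (X * constSeries E) := by
    ext1 n
    rw [coeff_constSeries, hw, coeff_complex_smul, coeff_complex_smul, map_smul,
      ← coeff_constSeries, map_mul]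
    simp [constSeries]
  have hCa : (C a : (strongFamilies 𝓗)⟦X⟧) = Complex.I • C h := by
    ext1 n
    rw [coeff_complex_smul, coeff_C, coeff_C]
    split_ifs
    · exact ha
    · exact (smul_zero _).symm
  have hY' : SeriesDeriv (psExp (magnusSeries a)) (psExp (magnusSeries a) * (X * C a)) :=
    SeriesDeriv.psExp (X_dvd_magnusSeries a) (Dvd.intro _ rfl) (seriesDeriv_magnusSeries a)
  have hZ' := ((seriesDeriv_psExp_timeFamily_mul hXw).mul (seriesDeriv_iterGen E h)).sub hY'
  set G := psExp (C (timeFamily 𝓗) * constSeries w) with hG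
  have hev : ∀ t : ℝ, (∀ j n, evalAt t (coeff n (iterSeries E h (j + 1))) = 0) →
      evalSeries t (G * iterGen E h - psExp (magnusSeries a)) =
      psExp ((t : ℂ) • w) - psExp (evalSeries t (magnusSeries a)) := by
    intro t ht
    have h3 : evalSeries t (C (timeFamily 𝓗) * constSeries w) = (t : ℂ) • w := by
      ext1 n
      rw [coeff_evalSeries, coeff_C_mul, map_mul, coeff_constSeries, evalAt_timeFamily,
        smul_mul_assoc, one_mul]
      rfl
    rw [map_sub, map_mul, evalSeries_iterGen E h ht, mul_one, hG, evalSeries_psExp, h3,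
      evalSeries_psExp]
  refine eq_zero_of_seriesDeriv (Z := G * iterGen E h - psExp (magnusSeries a)) (G := G) (a := a)
    ?_ (coeff_zero_psExp _) ?_ ?_ ?_
  · rw [hCa, leibniz_identity (commute_X G) (commute_X (psExp (magnusSeries a))) (iterGen E h)
      (constSeries E), ← hcw, ← hCa]
    exact hZ'
  · rw [map_sub, coeff_mul, Nat.antidiagonal_zero, sum_singleton, hG, coeff_zero_psExp,
      coeff_zero_psExp, coeff_zero_iterGen, mul_one, sub_self]
  · have hΩ0 : evalSeries 0 (magnusSeries a) = 0 := by
      ext1 n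
      rw [coeff_evalSeries, magnusSeries, coeff_mk, map_zero]
      exact evalAt_zero_magnusFamily a n
    rw [hev 0 fun j n => evalAt_zero_iterSeries_succ E h j n, hΩ0, Complex.ofReal_zero, zero_smul,
      sub_self]
  · rw [hev 1 fun j n => evalAt_one_iterSeries_succ E h j n, ← hw1, Complex.ofReal_one, one_smul,
      sub_self]

end EffectiveSeries

/-! ### Families that are polynomial in the period -/

section PolynomialFamilies

variable {R S : Type*} [Ring R] [Algebra ℂ R] [Ring S] [Algebra ℂ S]

/-- Evaluation of polynomials with coefficients in a noncommutative algebra at the central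
element `T`. -/
def evalPoly (T : ℝ) : Polynomial R →+* R :=
  Polynomial.eval₂RingHom' (RingHom.id R) (algebraMap ℂ R T) fun a => (Algebra.commutes _ a).symm

theorem evalPoly_eq_sum_support (T : ℝ) (p : Polynomial R) :
    evalPoly T p = ∑ k ∈ p.support, ((T ^ k : ℝ) : ℂ) • p.coeff k := by
  change p.eval₂ (RingHom.id R) (algebraMap ℂ R T) = _
  rw [Polynomial.eval₂_eq_sum, Polynomial.sum]
  refine sum_congr rfl fun k _ => ?_
  rw [RingHom.id_apply, ← map_pow, ← Algebra.commutes, ← Algebra.smul_def, Complex.ofReal_pow]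

theorem evalPoly_eq_sum_range (T : ℝ) {p : Polynomial R} {N : ℕ} (hN : ∀ n, N ≤ n → p.coeff n = 0) :
    evalPoly T p = ∑ k ∈ range N, ((T ^ k : ℝ) : ℂ) • p.coeff k := by
  rw [evalPoly_eq_sum_support]
  refine sum_subset (fun k hk => ?_) fun k _ hk => ?_
  · by_contra h
    exact Polynomial.mem_support_iff.1 hk (hN k (by simpa using h))
  · rw [Polynomial.notMem_support_iff.1 hk, smul_zero]

/-- The family `F` depends polynomially on `T > 0`, with coefficients those of the series `f`. -/
def IsPolyFamily (F : ℝ → R) (f : R⟦X⟧) : Prop :=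
  ∃ p : Polynomial R, (∀ n, p.coeff n = coeff n f) ∧ ∀ T : ℝ, 0 < T → F T = evalPoly T p

theorem IsPolyFamily.sub {F G : ℝ → R} {f g : R⟦X⟧} (hF : IsPolyFamily F f)
    (hG : IsPolyFamily G g) : IsPolyFamily (fun T => F T - G T) (f - g) := by
  obtain ⟨p, hp, hF⟩ := hF
  obtain ⟨q, hq, hG⟩ := hG
  exact ⟨p - q, fun n => by rw [Polynomial.coeff_sub, map_sub, hp, hq],
    fun T hT => by simp only [map_sub, hF T hT, hG T hT]⟩

theorem IsPolyFamily.mul {F G : ℝ → R} {f g : R⟦X⟧} (hF : IsPolyFamily F f)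
    (hG : IsPolyFamily G g) : IsPolyFamily (fun T => F T * G T) (f * g) := by
  obtain ⟨p, hp, hF⟩ := hF
  obtain ⟨q, hq, hG⟩ := hG
  exact ⟨p * q, fun n => by simp only [Polynomial.coeff_mul, coeff_mul, hp, hq],
    fun T hT => by simp only [map_mul, hF T hT, hG T hT]⟩

theorem isPolyFamily_C (a : R) : IsPolyFamily (fun _ => a) (C a) :=
  ⟨Polynomial.C a, fun n => by rw [Polynomial.coeff_C, coeff_C],
    fun T _ => (Polynomial.eval₂_C (RingHom.id R) (algebraMap ℂ R T)).symm⟩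

theorem isPolyFamily_pow (j : ℕ) :
    IsPolyFamily (fun T => ((T : ℂ) ^ j) • (1 : R)) (X ^ j : R⟦X⟧) := by
  refine ⟨Polynomial.X ^ j, fun n => by rw [Polynomial.coeff_X_pow, coeff_X_pow], fun T _ => ?_⟩
  rw [map_pow]
  change _ = (Polynomial.X.eval₂ (RingHom.id R) (algebraMap ℂ R T)) ^ j
  rw [Polynomial.eval₂_X, ← map_pow, Algebra.algebraMap_eq_smul_one]

theorem IsPolyFamily.sum {ι : Type*} {s : Finset ι} {F : ι → ℝ → R} {f : ι → R⟦X⟧}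
    (h : ∀ i, IsPolyFamily (F i) (f i)) :
    IsPolyFamily (fun T => ∑ i ∈ s, F i T) (∑ i ∈ s, f i) := by
  choose p hp hF using h
  refine ⟨∑ i ∈ s, p i, fun n => ?_, fun T hT => ?_⟩
  · rw [Polynomial.finsetSum_coeff, map_sum]
    exact sum_congr rfl fun i _ => hp i n
  · rw [map_sum]
    exact sum_congr rfl fun i _ => hF i T hT

/-- Linear maps act on the coefficients. -/
theorem IsPolyFamily.map {F : ℝ → R} {f : R⟦X⟧} (hF : IsPolyFamily F f) (φ : R →ₗ[ℂ] S)
    {G : ℝ → S} {g : S⟦X⟧} (hG : ∀ T, G T = φ (F T)) (hg : ∀ n, coeff n g = φ (coeff n f)) :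
    IsPolyFamily G g := by
  obtain ⟨p, hp, hF⟩ := hF
  have hz : ∀ n, p.natDegree + 1 ≤ n → p.coeff n = 0 := fun n hn =>
    Polynomial.coeff_eq_zero_of_natDegree_lt hn
  have hq : ∀ n, (∑ k ∈ range (p.natDegree + 1), Polynomial.monomial k (φ (p.coeff k))).coeff n =
      φ (p.coeff n) := by
    intro n
    rw [Polynomial.finsetSum_coeff]
    simp only [Polynomial.coeff_monomial, sum_ite_eq']
    split_ifs with h
    · rfl
    · rw [hz n (by simpa using h), map_zero]
  refine ⟨_, fun n => by rw [hq, hg, hp], fun T hT => ?_⟩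
  rw [hG, hF T hT, evalPoly_eq_sum_range T hz,
    evalPoly_eq_sum_range T (N := p.natDegree + 1) fun n hn => by rw [hq, hz n hn, map_zero], map_sum]
  exact sum_congr rfl fun k _ => by rw [hq, map_smul]

theorem IsPolyFamily.smul {F : ℝ → R} {f : R⟦X⟧} (hF : IsPolyFamily F f) (c : ℂ) :
    IsPolyFamily (fun T => c • F T) (c • f) :=
  hF.map (c • LinearMap.id) (fun _ => rfl) fun n => coeff_complex_smul n c f

theorem IsPolyFamily.pow_smul {F : ℝ → R} {f : R⟦X⟧} (hF : IsPolyFamily F f) (j : ℕ) :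
    IsPolyFamily (fun T => ((T : ℂ) ^ j) • F T) (X ^ j * f) := by
  simpa using (isPolyFamily_pow j).mul hF

theorem isPolyFamily_trunc {F : ℝ → R} {f : R⟦X⟧} {N : ℕ}
    (h : ∀ T : ℝ, 0 < T → F T = ∑ k ∈ range N, ((T ^ k : ℝ) : ℂ) • coeff k f) :
    IsPolyFamily F (trunc N f : Polynomial R) := by
  refine ⟨trunc N f, fun n => (Polynomial.coeff_coe _ n).symm, fun T hT => ?_⟩
  rw [h T hT, evalPoly_eq_sum_range T (N := N) fun n hn => by
    rw [coeff_trunc, if_neg (by omega)]]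
  refine sum_congr rfl fun k hk => ?_
  rw [coeff_trunc, if_pos (by simpa using hk)]

end PolynomialFamilies

/-! ### From formal series back to operators -/

section Evaluation

variable {𝓗 : Type*} [NormedAddCommGroup 𝓗] [InnerProductSpace ℂ 𝓗]

theorem IsPolyFamily.polyCoeff_eq {F : ℝ → 𝓗 →L[ℂ] 𝓗} {f : (𝓗 →L[ℂ] 𝓗)⟦X⟧}
    (hF : IsPolyFamily F f) (k : ℕ) : polyCoeff F k = coeff k f := by
  obtain ⟨p, hp, hF⟩ := hF
  have hc : IsPolynomialWith F
      ⟨p.support, p.coeff, fun n => Polynomial.mem_support_iff⟩ := fun T hT => by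
    rw [hF T hT, evalPoly_eq_sum_support]
    rfl
  rw [hc.polyCoeff_eq]
  exact hp k

variable [CompleteSpace 𝓗]

/-- The iterated actions for period `1`, formed with a constant operator `A` on the left and the
family `h` on the right. -/
def iterFamily (A : 𝓗 →L[ℂ] 𝓗) (h : strongFamilies 𝓗) : ℕ → strongFamilies 𝓗
  | 0 => 1
  | j + 1 => integralMap (constFamily A * iterFamily A h j - iterFamily A h j * h) -
      timeFamily 𝓗 * constFamily (evalAt 1 (integralMap
        (constFamily A * iterFamily A h j - iterFamily A h j * h)))

theorem isPolyFamily_integrand {F : ℝ → 𝓗 →L[ℂ] 𝓗} {f : (𝓗 →L[ℂ] 𝓗)⟦X⟧} (hF : IsPolyFamily F f)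
    {G : ℝ → strongFamilies 𝓗} {g : (strongFamilies 𝓗)⟦X⟧} (hG : IsPolyFamily G g)
    (h : strongFamilies 𝓗) :
    IsPolyFamily (fun T => constFamily (F T) * G T - G T * h) (constSeries f * g - g * C h) :=
  ((hF.map (constFamily (𝓗 := 𝓗)).toLinearMap (fun _ => rfl)
    fun n => coeff_constSeries n f).mul hG).sub (hG.mul (isPolyFamily_C h))

theorem isPolyFamily_iterFamily {F : ℝ → 𝓗 →L[ℂ] 𝓗} {f : (𝓗 →L[ℂ] 𝓗)⟦X⟧}
    (hF : IsPolyFamily F f) (h : strongFamilies 𝓗) (j : ℕ) :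
    IsPolyFamily (fun T => iterFamily (F T) h j) (iterSeries f h j) := by
  induction j with
  | zero =>
    have := isPolyFamily_C (1 : strongFamilies 𝓗)
    rwa [map_one] at this
  | succ j ih =>
    exact (isPolyFamily_integrand hF ih h).map (integralMap - LinearMap.mulLeft ℂ (timeFamily 𝓗) ∘ₗ
      (constFamily (𝓗 := 𝓗)).toLinearMap ∘ₗ (evalAt 1).toLinearMap ∘ₗ integralMap)
      (fun _ => rfl) fun n => by rw [iterSeries, coeff_mk]; rfl

theorem isPolyFamily_mean {F : ℝ → 𝓗 →L[ℂ] 𝓗} {f : (𝓗 →L[ℂ] 𝓗)⟦X⟧}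
    (hF : IsPolyFamily F f) (h : strongFamilies 𝓗) (j : ℕ) :
    IsPolyFamily (fun T => evalAt 1 (integralMap
      (constFamily (F T) * iterFamily (F T) h j - iterFamily (F T) h j * h))) (meanSeries f h j) :=
  (isPolyFamily_integrand hF (isPolyFamily_iterFamily hF h j) h).map
    ((evalAt 1).toLinearMap ∘ₗ integralMap) (fun _ => rfl)
    fun n => by rw [meanSeries, coeff_mk]; rfl

/-- The integral of a family which is a rescaled copy of `k`. -/
theorem strongIntegral_rescaled (T : ℝ) (hT : 0 < T) (c : ℂ) (k : strongFamilies 𝓗)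
    {B : ℝ → 𝓗 →L[ℂ] 𝓗} (hB : ∀ s, B s = c • evalAt (s / T) k) (s : ℝ) :
    strongIntegral B s = ((T : ℂ) * c) • evalAt (s / T) (integralMap k) := by
  have hBc : StronglyContinuous B := fun ψ => by
    simp only [hB, _root_.smul_apply]
    exact ((k.2 ψ).comp (continuous_id.div_const T)).const_smul c
  have h := strongIntegral_mul_left k.2 hBc T c (fun s => by
    rw [hB, mul_div_cancel_left₀ s hT.ne']; rfl) (s / T)
  rwa [mul_div_cancel₀ s hT.ne'] at h

theorem average_rescaled (T : ℝ) (hT : 0 < T) (c : ℂ) (k : strongFamilies 𝓗)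
    {B : ℝ → 𝓗 →L[ℂ] 𝓗} (hB : ∀ s, B s = c • evalAt (s / T) k) :
    average T B = c • evalAt 1 (integralMap k) := by
  have hT' : (T : ℂ) ≠ 0 := Complex.ofReal_ne_zero.2 hT.ne'
  rw [average, strongIntegral_rescaled T hT c k hB, div_self hT.ne', smul_smul]
  congr 1
  push_cast
  field_simp

/-- The iterated actions for period `T`, in the rescaled time `s / T`, are those for period `1`
up to the factor `T ^ j`. -/
theorem iterAction_eq (A : 𝓗 →L[ℂ] 𝓗) (h : strongFamilies 𝓗) {T : ℝ} (hT : 0 < T) (j : ℕ) (s : ℝ) :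
    iterAction T (fun _ => A) (rescale h T) j s =
      ((T : ℂ) ^ j) • evalAt (s / T) (iterFamily A h j) := by
  induction j generalizing s with
  | zero => simp [iterAction, iterFamily]
  | succ j ih =>
    have hT' : (T : ℂ) ≠ 0 := Complex.ofReal_ne_zero.2 hT.ne'
    have hB : ∀ s, relAction (fun _ => A) (rescale h T) s
        (iterAction T (fun _ => A) (rescale h T) j s) = ((T : ℂ) ^ j) • evalAt (s / T)
          (constFamily A * iterFamily A h j - iterFamily A h j * h) := fun s => by
      rw [relAction, ih, map_sub, map_mul, map_mul, evalAt_constFamily, smul_sub, mul_smul_comm,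
        smul_mul_assoc]
      rfl
    change strongIntegral (fun s => relAction (fun _ => A) (rescale h T) s
      (iterAction T (fun _ => A) (rescale h T) j s)) s - (s : ℂ) • average T (fun s =>
      relAction (fun _ => A) (rescale h T) s (iterAction T (fun _ => A) (rescale h T) j s)) = _
    rw [strongIntegral_rescaled T hT _ _ hB, average_rescaled T hT _ _ hB, iterFamily,
      map_sub (evalAt (s / T)) _ (timeFamily 𝓗 * _), map_mul (evalAt (s / T)) (timeFamily 𝓗),
      evalAt_timeFamily, evalAt_constFamily, smul_sub, smul_mul_assoc, one_mul, ← pow_succ', smul_smul,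
      smul_smul]
    congr 2
    push_cast
    field_simp
    rw [pow_succ, mul_assoc]

/-- Up to the factor `T ^ j`, the averages in the recursion for the effective Hamiltonian are those
for period `1`. -/
theorem average_relAction_eq (A : 𝓗 →L[ℂ] 𝓗) (h : strongFamilies 𝓗) {T : ℝ} (hT : 0 < T) (j : ℕ) :
    average T (fun s => relAction (fun _ => A) (rescale h T) s
      (iterAction T (fun _ => A) (rescale h T) j s)) = ((T : ℂ) ^ j) • evalAt 1 (integralMap
        (constFamily A * iterFamily A h j - iterFamily A h j * h)) := by
  refine average_rescaled T hT _ _ fun s => ?_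
  rw [relAction, iterAction_eq A h hT, map_sub, map_mul, map_mul, evalAt_constFamily, smul_sub,
    mul_smul_comm, smul_mul_assoc]
  rfl

/-- Coefficients up to order `N` of a product depend only on coefficients up to order `N`. -/
theorem coeff_mul_congr {R : Type*} [Ring R] {f f' g g' : R⟦X⟧} {N n : ℕ} (hn : n ≤ N)
    (hf : ∀ m ≤ N, coeff m f = coeff m f') (hg : ∀ m ≤ N, coeff m g = coeff m g') :
    coeff n (f * g) = coeff n (f' * g') := by
  rw [coeff_mul, coeff_mul]
  refine sum_congr rfl fun p hp => ?_
  rw [HasAntidiagonal.mem_antidiagonal] at hp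
  rw [hf p.1 (by omega), hg p.2 (by omega)]

theorem coeff_integrand_congr {E E' : (𝓗 →L[ℂ] 𝓗)⟦X⟧} (h : strongFamilies 𝓗) {N : ℕ}
    (hE : ∀ m ≤ N, coeff m E = coeff m E') {S S' : (strongFamilies 𝓗)⟦X⟧}
    (hS : ∀ m ≤ N, coeff m S = coeff m S') {n : ℕ} (hn : n ≤ N) :
    coeff n (constSeries E * S - S * C h) = coeff n (constSeries E' * S' - S' * C h) := by
  have hE' : ∀ m ≤ N, coeff m (constSeries E) = coeff m (constSeries E') := fun m hm => by
    rw [coeff_constSeries, coeff_constSeries, hE m hm]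
  rw [map_sub, map_sub, coeff_mul_C, coeff_mul_C, hS n hn, coeff_mul_congr hn hE' hS]

theorem coeff_iterSeries_congr {E E' : (𝓗 →L[ℂ] 𝓗)⟦X⟧} (h : strongFamilies 𝓗) {N : ℕ}
    (hE : ∀ m ≤ N, coeff m E = coeff m E') (j : ℕ) :
    ∀ n ≤ N, coeff n (iterSeries E h j) = coeff n (iterSeries E' h j) := by
  induction j with
  | zero => exact fun _ _ => rfl
  | succ j ih =>
    intro n hn
    rw [iterSeries, iterSeries, coeff_mk, coeff_mk, coeff_integrand_congr h hE ih hn]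

/-- The coefficients of the averages up to order `N` depend on `E` only up to order `N`. In the
recursion for the effective Hamiltonian of order `L` the `j`-th average carries a factor `T ^ j`, so that the
effective Hamiltonian of order `L - j` may replace the full series there. -/
theorem coeff_meanSeries_congr {E E' : (𝓗 →L[ℂ] 𝓗)⟦X⟧} (h : strongFamilies 𝓗) {N : ℕ}
    (hE : ∀ m ≤ N, coeff m E = coeff m E') (j : ℕ) {n : ℕ} (hn : n ≤ N) :
    coeff n (meanSeries E h j) = coeff n (meanSeries E' h j) := by
  rw [meanSeries, meanSeries, coeff_mk, coeff_mk,
    coeff_integrand_congr h hE (coeff_iterSeries_congr h hE j) hn]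

theorem meanSeries_zero (E : (𝓗 →L[ℂ] 𝓗)⟦X⟧) (h : strongFamilies 𝓗) :
    meanSeries E h 0 = E - C (evalAt 1 (integralMap h)) := by
  have hconst : ∀ A : 𝓗 →L[ℂ] 𝓗, evalAt 1 (integralMap (constFamily A)) = A := fun A => by
    rw [← (hasStrongDeriv_timeFamily_mul A).eq_integralMap, map_mul, evalAt_timeFamily,
      evalAt_constFamily, Complex.ofReal_one, one_smul, one_mul]
    rw [map_mul, evalAt_timeFamily, Complex.ofReal_zero, zero_smul, zero_mul]
  ext1 n
  rw [meanSeries, coeff_mk, iterSeries, mul_one, one_mul, map_sub, map_sub, map_sub, map_sub,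
    coeff_constSeries, hconst, coeff_C, coeff_C]
  split_ifs
  · rfl
  · rw [map_zero, map_zero]

/-- The recursion for the coefficients of the formal Floquet-Magnus Hamiltonian. -/
theorem coeff_floquetSeries_eq (h : strongFamilies 𝓗) {k L : ℕ} (hk : k ≤ L) :
    coeff k (floquetSeries h) = coeff k (C (evalAt 1 (integralMap h)) -
      ∑ j : Fin L, (-Complex.I) ^ (j.val + 1) •
        (X ^ (j.val + 1) * meanSeries (floquetSeries h) h (j.val + 1))) := by
  have h0 := congrArg (coeff k) (meanGen_floquetSeries h)
  rw [meanGen, coeff_lsum (fun j => X_pow_dvd_smul_X_pow_mul _ j _) (Nat.lt_succ_of_le hk),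
    sum_range_succ', pow_zero, pow_zero, one_smul, one_mul, meanSeries_zero, map_zero,
    ← Fin.sum_univ_eq_sum_range (fun j => coeff k ((-Complex.I) ^ (j + 1) •
      (X ^ (j + 1) * meanSeries (floquetSeries h) h (j + 1)))), map_sub] at h0
  rw [map_sub, map_sum, eq_sub_iff_add_eq, ← sub_eq_zero, ← h0]
  abel

/-- The effective Hamiltonian of order `L` is the formal Floquet-Magnus Hamiltonian truncated to
degree `L`. -/
theorem Heff_eq_sum (h : strongFamilies 𝓗) (L : ℕ) {T : ℝ} :
    0 < T → Heff (h : ℝ → 𝓗 →L[ℂ] 𝓗) L T =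
      ∑ k ∈ range (L + 1), ((T ^ k : ℝ) : ℂ) • coeff k (floquetSeries h) := by
  induction L using Nat.strong_induction_on generalizing T with
  | _ L ih =>
    intro hT
    obtain ⟨F, hF, hpoly⟩ : ∃ F, Heff (h : ℝ → 𝓗 →L[ℂ] 𝓗) L = polyTrunc F L ∧ IsPolyFamily F
        (C (evalAt 1 (integralMap h)) - ∑ j : Fin L, (-Complex.I) ^ (j.val + 1) •
          (X ^ (j.val + 1) * meanSeries
            (trunc (L - (j.val + 1) + 1) (floquetSeries h) : Polynomial (𝓗 →L[ℂ] 𝓗))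
            h (j.val + 1))) := by
      refine ⟨_, by rw [Heff], ?_⟩
      have hH : ∀ j : Fin L, IsPolyFamily (fun T => Heff (h : ℝ → 𝓗 →L[ℂ] 𝓗) (L - (j.val + 1)) T)
          (trunc (L - (j.val + 1) + 1) (floquetSeries h) : Polynomial (𝓗 →L[ℂ] 𝓗)) := fun j =>
        isPolyFamily_trunc fun T hT => ih (L - (j.val + 1)) (by have := j.isLt; omega) hT
      obtain ⟨p, hp, hF⟩ := (isPolyFamily_C (evalAt 1 (integralMap h))).sub
        (IsPolyFamily.sum (s := univ) fun j : Fin L => (((isPolyFamily_mean (hH j) h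
          (j.val + 1)).pow_smul (j.val + 1)).smul ((-Complex.I) ^ (j.val + 1))))
      refine ⟨p, hp, fun T hT => ?_⟩
      rw [← hF T hT, average]
      simp only [average_relAction_eq _ h hT]
      rw [div_one, Complex.ofReal_one, one_smul, evalAt_integralMap]
    rw [hF, polyTrunc]
    refine sum_congr rfl fun k hk => ?_
    have hkL : k ≤ L := Nat.lt_succ_iff.1 (mem_range.1 hk)
    refine congrArg _ ((hpoly.polyCoeff_eq k).trans
      (Eq.trans ?_ (coeff_floquetSeries_eq h hkL).symm))
    rw [map_sub (coeff k), map_sub (coeff k), map_sum (coeff k), map_sum (coeff k)]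
    refine congrArg _ ?_
    refine sum_congr rfl fun j _ => ?_
    rw [coeff_complex_smul, coeff_complex_smul, coeff_X_pow_mul', coeff_X_pow_mul']
    split_ifs with hj
    · rw [coeff_meanSeries_congr h (N := L - (j.val + 1)) (fun m hm => ?_) _ (by omega)]
      rw [Polynomial.coeff_coe, coeff_trunc, if_pos (by omega)]
    · rfl

/-- The terms of the Floquet-Magnus expansion are the homogeneous parts of the formal one. -/
theorem HFMTerm_eq (h : strongFamilies 𝓗) (l : ℕ) {T : ℝ} (hT : 0 < T) :
    HFMTerm (h : ℝ → 𝓗 →L[ℂ] 𝓗) l T = ((T ^ l : ℝ) : ℂ) • coeff l (floquetSeries h) := by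
  have hT' : (T : ℂ) ≠ 0 := Complex.ofReal_ne_zero.2 hT.ne'
  have hB : StronglyContinuous fun t => Complex.I • rescale h T t := fun ψ =>
    ((StronglyContinuous.rescale h.2 T) ψ).const_smul Complex.I
  have hs : ∀ s, Complex.I • rescale h T (T * s) =
      ((Complex.I • h : strongFamilies 𝓗) : ℝ → 𝓗 →L[ℂ] 𝓗) s := fun s => by
    rw [rescale, mul_div_cancel_left₀ s hT.ne']
    rfl
  have hm := magnusTerm_mul_left (Complex.I • h : strongFamilies 𝓗).2 hB hs (l + 1) 1
  rw [mul_one] at hm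
  rw [HFMTerm, hm, coeff_floquetSeries, evalAt_magnusFamily, smul_smul, smul_smul]
  congr 1
  push_cast
  field_simp
  rw [pow_succ']

theorem Heff_eq_HFM (h : strongFamilies 𝓗) (L : ℕ) {T : ℝ} (hT : 0 < T) :
    Heff (h : ℝ → 𝓗 →L[ℂ] 𝓗) L T = HFM (h : ℝ → 𝓗 →L[ℂ] 𝓗) L T := by
  rw [Heff_eq_sum h L hT, HFM]
  exact sum_congr rfl fun l _ => (HFMTerm_eq h l hT).symm

theorem isSelfAdjoint_HFM (h : strongFamilies 𝓗) (hs : ∀ t, IsSelfAdjoint (evalAt t h)) (L : ℕ)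
    {T : ℝ} : IsSelfAdjoint (HFM (h : ℝ → 𝓗 →L[ℂ] 𝓗) L T) := by
  rw [IsSelfAdjoint, HFM, star_sum]
  refine sum_congr rfl fun l _ => ?_
  have hB : StronglyContinuous fun t => Complex.I • rescale h T t := fun ψ =>
    ((StronglyContinuous.rescale h.2 T) ψ).const_smul Complex.I
  rw [HFMTerm, star_smul, star_magnusTerm hB, smul_neg, ← neg_smul]
  · congr 1
    simp [neg_div]
  · intro s
    have h1 : star (evalAt (s / T) h) = evalAt (s / T) h := hs (s / T)
    have h2 : evalAt (s / T) h = rescale (h : ℝ → 𝓗 →L[ℂ] 𝓗) T s := rfl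
    rw [h2] at h1
    rw [star_smul, h1, ← neg_smul, Complex.star_def, Complex.conj_I]

end Evaluation

end FloquetMagnus

end

theorem mainTheorem6 {𝓗 : Type*} [NormedAddCommGroup 𝓗] [InnerProductSpace ℂ 𝓗] [CompleteSpace 𝓗]
    (H : ℝ → 𝓗 →L[ℂ] 𝓗) (hcont : FloquetMagnus.StronglyContinuous H)
    (hper : ∀ t : ℝ, H (t + 1) = H t) :
    (∀ (L : ℕ) (T : ℝ), 0 < T → FloquetMagnus.Heff H L T = FloquetMagnus.HFM H L T) ∧
    ((∀ t : ℝ, (H t : 𝓗 →ₗ[ℂ] 𝓗).IsSymmetric) →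
      ∀ (L : ℕ) (T : ℝ), 0 < T →
        (FloquetMagnus.Heff H L T : 𝓗 →ₗ[ℂ] 𝓗).IsSymmetric ∧
        IsSelfAdjoint (FloquetMagnus.Heff H L T)) := by
  have heq : ∀ (L : ℕ) (T : ℝ), 0 < T → FloquetMagnus.Heff H L T = FloquetMagnus.HFM H L T :=
    fun L T hT => FloquetMagnus.Heff_eq_HFM ⟨H, hcont⟩ L hT
  refine ⟨heq, fun hsym L T hT => ?_⟩
  have hsa : IsSelfAdjoint (FloquetMagnus.Heff H L T) := by
    rw [heq L T hT]
    exact FloquetMagnus.isSelfAdjoint_HFM ⟨H, hcont⟩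
      (fun t => ContinuousLinearMap.isSelfAdjoint_iff_isSymmetric.2 (hsym t)) L
  exact ⟨ContinuousLinearMap.isSelfAdjoint_iff_isSymmetric.1 hsa, hsa⟩
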